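/- All metric spaces below are proper (closed balls are compact) and geodesic. For a metric space $X$ put $(x|y)_o=\frac12\big(d_X(x,o)+d_X(y,o)-d_X(x,y)\big)$; $X$ is Gromov hyperbolic if for some $\delta\ge 0$ one has $(x|y)_o\ge\min\{(x|z)_o,(z|y)_o\}-\delta$ for all $x,y,z,o\in X$. A sequence $(x_n)$ is a Gromov sequence if $(x_m|x_n)_o\to\infty$ as $m,n\to\infty$; two Gromov sequences are equivalent if $(x_n|x_n')_o\to\infty$; the Gromov boundary $\partial_\infty X$ is the set of equivalence classes. For $\xi\in\partial_\infty X$ let $(x|\xi)_o=\inf\{\liminf_{n}(x|x_n)_o:(x_n)\in\xi\}$, and let $b_{\xi,o}(x)=(\xi|o)_x-(\xi|x)_o$ be the Busemann function based at $\xi$ with base point $o$. For $\epsilon>0$ the conformal deformation of $X$ (with respect to $\xi$ and $o$) is $X_\epsilon=(X,d_\epsilon)$, where $d_\epsilon(x,x')=\inf_\gamma\int_\gamma e^{-\epsilon b_{\xi,o}}\,ds$, the infimum being over all rectifiable curves in $X$ from $x$ to $x'$. $X$ is roughly starlike with respect to $\xi\in\partial_\infty X$ if there is $K\ge0$ such that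 every point of $X$ is within distance $K$ of some geodesic line joining $\xi$ to some $\zeta\in\partial_\infty X$. A metric space $(M,d)$ is uniform if it is locally compact and not complete and there is $A\ge1$ such that any $x,y\in M$ are joined by a rectifiable curve $\gamma$ with $l(\gamma)\le A\,d(x,y)$ and $\min\{l(\gamma[x,z]),l(\gamma[z,y])\}\le A\,d(z,\partial M)$ for all $z$ on $\gamma$, where $\partial M=\overline M\setminus M$ and $\overline M$ is the metric completion. A map $\phi:Y\to X$ is a $\lambda$-rough isometry if $d_Y(y_1,y_2)-\lambda\le d_X(\phi(y_1),\phi(y_2))\le d_Y(y_1,y_2)+\lambda$ for all $y_1,y_2\in Y$ and, for some $\tau$, every point of $X$ is within distance $\tau$ of $\phi(Y)$. For such $\phi$ and $\omega\in\partial_\infty Y$, $\phi(\omega)\in\partial_\infty X$ denotes the class of $(\phi(y_n))$ for $(y_n)\in\omega$. **Theorem.** Let $\phi:Y\to X$ be a $\lambda$-rough isometry between proper geodesic Gromov hyperbolic spaces, let $\omega\in\partial_\infty Y$ and $\omega'=\phi(\omega)\in\partial_\infty X$, and let $o\in Y$, $o'\in X$ be base points (for instance $o'=\phi(o)$). Suppose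 that $X$ is roughly starlike with respect to $\omega'$, and let $\epsilon>0$ be such that $X_\epsilon$, the conformal deformation of $X$ with density $e^{-\epsilon b_{\omega',o'}}$, is a uniform space. Then $Y_\epsilon$, the conformal deformation of $Y$ with density $e^{-\epsilon b_{\omega,o}}$, is also a uniform space. -/

import Mathlib

open Set Filter Topology

/-! ### Geodesic spaces and Gromov hyperbolicity -/

/-- A metric space is geodesic if any two points are joined by an isometric copy of the
interval `[0, dist x y]`. -/
class GeodesicSpace (X : Type*) [MetricSpace X] : Prop where
  exists_geodesic : ∀ x y : X, ∃ γ : ℝ → X, γ 0 = x ∧ γ (dist x y) = y ∧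
    ∀ s ∈ Icc 0 (dist x y), ∀ t ∈ Icc 0 (dist x y), dist (γ s) (γ t) = |s - t|

/-- The Gromov product `(x | y)_o`. -/
noncomputable def gromovProduct {X : Type*} [MetricSpace X] (o x y : X) : ℝ :=
  (dist x o + dist y o - dist x y) / 2

/-- Gromov hyperbolicity: the four-point condition holds for some `δ ≥ 0`. -/
class GromovHyperbolicSpace (X : Type*) [MetricSpace X] : Prop where
  exists_delta : ∃ δ : ℝ, 0 ≤ δ ∧ ∀ x y z o : X,
    min (gromovProduct o x z) (gromovProduct o z y) - δ ≤ gromovProduct o x y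

section GromovProduct

variable {X : Type*} [MetricSpace X]

theorem gromovProduct_nonneg (o x y : X) : 0 ≤ gromovProduct o x y := by
  have := dist_triangle_right x y o
  unfold gromovProduct; linarith

theorem gromovProduct_le_right (o x y : X) : gromovProduct o x y ≤ dist x o := by
  have := dist_triangle_left y o x
  unfold gromovProduct; linarith

theorem gromovProduct_comm (o x y : X) : gromovProduct o x y = gromovProduct o y x := by
  unfold gromovProduct; rw [dist_comm x y]; ring

theorem gromovProduct_base (o o' x y : X) :
    gromovProduct o x y ≤ gromovProduct o' x y + dist o o' := by
  have h1 := dist_triangle x o' o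
  have h2 := dist_triangle y o' o
  rw [dist_comm o' o] at h1 h2
  unfold gromovProduct; linarith

theorem gromovProduct_left (o x x' y : X) :
    gromovProduct o x y ≤ gromovProduct o x' y + dist x x' := by
  have h1 := dist_triangle x x' o
  have h2 := dist_triangle_left x' y x
  unfold gromovProduct; linarith

end GromovProduct

/-! ### The Gromov boundary -/

/-- `u` is a Gromov sequence: `(u m | u n)_o → ∞` as `m, n → ∞`.  (The condition does not depend
on the base point `o`.) -/
def IsGromovSeq {X : Type*} [MetricSpace X] (u : ℕ → X) : Prop :=
  ∀ o : X, Tendsto (fun p : ℕ × ℕ => gromovProduct o (u p.1) (u p.2)) atTop atTop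

/-- The type of Gromov sequences in `X`. -/
def GromovSeq (X : Type*) [MetricSpace X] : Type _ := {u : ℕ → X // IsGromovSeq u}

/-- Two Gromov sequences are equivalent if `(u n | v n)_o → ∞`. -/
def gromovSetoid (X : Type*) [MetricSpace X] [GromovHyperbolicSpace X] : Setoid (GromovSeq X) where
  r u v := ∀ o : X, Tendsto (fun n : ℕ => gromovProduct o (u.1 n) (v.1 n)) atTop atTop
  iseqv :=
    { refl := fun u o =>
        (u.2 o).comp (tendsto_atTop_diagonal : Tendsto (fun n : ℕ => (n, n)) atTop atTop)
      symm := fun {u v} h o => by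
        simpa only [gromovProduct_comm o (v.1 _) (u.1 _)] using h o
      trans := fun {u v w} h h' o => by
        obtain ⟨δ, -, hδ⟩ := GromovHyperbolicSpace.exists_delta (X := X)
        rw [tendsto_atTop]
        intro C
        filter_upwards [tendsto_atTop.1 (h o) (C + δ), tendsto_atTop.1 (h' o) (C + δ)] with n h1 h2
        have h3 := hδ (u.1 n) (w.1 n) (v.1 n) o
        have h4 := le_min h1 h2
        linarith }

/-- The Gromov boundary `∂_∞ X`: equivalence classes of Gromov sequences. -/
def GromovBoundary (X : Type*) [MetricSpace X] [GromovHyperbolicSpace X] : Type _ :=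
  Quotient (gromovSetoid X)

/-- The class in `∂_∞ X` of a Gromov sequence. -/
def GromovSeq.toBoundary {X : Type*} [MetricSpace X] [GromovHyperbolicSpace X]
    (u : GromovSeq X) : GromovBoundary X :=
  Quotient.mk (gromovSetoid X) u

/-- The sequence `u` in `X` is a Gromov sequence that belongs to the class `ξ`. -/
def RepresentsBoundary {X : Type*} [MetricSpace X] [GromovHyperbolicSpace X]
    (u : ℕ → X) (ξ : GromovBoundary X) : Prop :=
  ∃ h : IsGromovSeq u, GromovSeq.toBoundary ⟨u, h⟩ = ξ

/-- The Gromov product `(x | ξ)_o` of a point and a boundary point: the infimum of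
`liminf (x | u n)_o` over all Gromov sequences `u` in the class `ξ`. -/
noncomputable def gromovProductBoundary {X : Type*} [MetricSpace X] [GromovHyperbolicSpace X]
    (o x : X) (ξ : GromovBoundary X) : ℝ :=
  ⨅ u : {u : GromovSeq X // u.toBoundary = ξ},
    liminf (fun n : ℕ => gromovProduct o x (u.1.1 n)) atTop

/-- The canonical Busemann function `b_{ξ,o}(x) = (ξ | o)_x - (ξ | x)_o`. -/
noncomputable def busemann {X : Type*} [MetricSpace X] [GromovHyperbolicSpace X]
    (ξ : GromovBoundary X) (o x : X) : ℝ :=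
  gromovProductBoundary x o ξ - gromovProductBoundary o x ξ

section Busemann

variable {X : Type*} [MetricSpace X]

theorem liminf_gromovProduct_le {u : ℕ → X} {o x o' x' : X} {c : ℝ}
    (h : ∀ y, gromovProduct o x y ≤ gromovProduct o' x' y + c) :
    liminf (fun n : ℕ => gromovProduct o x (u n)) atTop ≤
      liminf (fun n : ℕ => gromovProduct o' x' (u n)) atTop + c := by
  have hb : ∀ p q : X, IsBoundedUnder (· ≥ ·) atTop (fun n : ℕ => gromovProduct p q (u n)) :=
    fun p q => isBoundedUnder_of ⟨0, fun n => gromovProduct_nonneg _ _ _⟩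
  have hb' : ∀ p q : X, IsCoboundedUnder (· ≥ ·) atTop (fun n : ℕ => gromovProduct p q (u n)) :=
    fun p q => (isBoundedUnder_of (r := (· ≤ ·))
      ⟨dist q p, fun n => gromovProduct_le_right _ _ _⟩).isCoboundedUnder_ge
  rw [← liminf_add_const _ _ c (hb' _ _) (hb _ _)]
  refine liminf_le_liminf (Eventually.of_forall fun n => h (u n)) (hb _ _) ?_
  exact (isBoundedUnder_of (r := (· ≤ ·))
    ⟨dist x' o' + c, fun n => by
      have := gromovProduct_le_right o' x' (u n); simpa using this⟩).isCoboundedUnder_ge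

variable [GromovHyperbolicSpace X]

instance GromovBoundary.nonempty_rep (ξ : GromovBoundary X) :
    Nonempty {u : GromovSeq X // u.toBoundary = ξ} := by
  obtain ⟨u, hu⟩ := Quotient.exists_rep ξ
  exact ⟨⟨u, hu⟩⟩

theorem gromovProductBoundary_le {ξ : GromovBoundary X} {o x o' x' : X} {c : ℝ}
    (h : ∀ y, gromovProduct o x y ≤ gromovProduct o' x' y + c) :
    gromovProductBoundary o x ξ ≤ gromovProductBoundary o' x' ξ + c := by
  rw [← sub_le_iff_le_add]
  refine le_ciInf fun u => ?_
  rw [sub_le_iff_le_add]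
  refine le_trans (ciInf_le ⟨0, ?_⟩ u) (liminf_gromovProduct_le h)
  rintro _ ⟨v, rfl⟩
  refine le_liminf_of_le ?_ (Eventually.of_forall fun n => gromovProduct_nonneg _ _ _)
  exact (isBoundedUnder_of (r := (· ≤ ·))
    ⟨dist x o, fun n => gromovProduct_le_right _ _ _⟩).isCoboundedUnder_ge

theorem busemann_le (ξ : GromovBoundary X) (o x y : X) :
    busemann ξ o x ≤ busemann ξ o y + 2 * dist x y := by
  have h1 : gromovProductBoundary x o ξ ≤ gromovProductBoundary y o ξ + dist x y :=
    gromovProductBoundary_le fun z => gromovProduct_base x y o z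
  have h2 : gromovProductBoundary o y ξ ≤ gromovProductBoundary o x ξ + dist x y :=
    gromovProductBoundary_le fun z => dist_comm x y ▸ gromovProduct_left o y x z
  unfold busemann; linarith

theorem continuous_busemann (ξ : GromovBoundary X) (o : X) : Continuous (busemann ξ o) :=
  (LipschitzWith.of_le_add_mul 2 fun x y => by simpa using busemann_le ξ o x y).continuous

end Busemann

/-! ### Rough isometries -/

/-- `φ : Y → X` is a `lam`-rough isometry: it distorts distances by at most the additive constant
`lam`, and its image is `τ`-dense in `X` for some `τ`. -/
def IsRoughIsometry {Y X : Type*} [MetricSpace Y] [MetricSpace X] (lam : ℝ) (φ : Y → X) : Prop :=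
  (∀ y₁ y₂ : Y, dist y₁ y₂ - lam ≤ dist (φ y₁) (φ y₂) ∧ dist (φ y₁) (φ y₂) ≤ dist y₁ y₂ + lam) ∧
    ∃ τ : ℝ, ∀ x : X, ∃ y : Y, dist x (φ y) ≤ τ

section RoughIsometry

variable {Y X : Type*} [MetricSpace Y] [MetricSpace X] {lam : ℝ} {φ : Y → X}

theorem IsRoughIsometry.gromovProduct_le (h : IsRoughIsometry lam φ) (o : X) (p : Y) :
    ∃ c : ℝ, ∀ x y : Y, gromovProduct p x y - c ≤ gromovProduct o (φ x) (φ y) := by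
  refine ⟨3 * lam / 2 + dist (φ p) o, fun x y => ?_⟩
  have h1 := (h.1 x p).1
  have h2 := (h.1 y p).1
  have h3 := (h.1 x y).2
  have h4 := gromovProduct_base (φ p) o (φ x) (φ y)
  unfold gromovProduct at *
  linarith

theorem IsRoughIsometry.isGromovSeq (h : IsRoughIsometry lam φ) {u : ℕ → Y} (hu : IsGromovSeq u) :
    IsGromovSeq (fun n => φ (u n)) := by
  intro o
  obtain ⟨c, hc⟩ := h.gromovProduct_le o (u 0)
  exact tendsto_atTop_mono (fun p => hc _ _) (tendsto_atTop_add_const_right _ (-c) (hu (u 0)))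

variable [GromovHyperbolicSpace Y] [GromovHyperbolicSpace X]

/-- The map `∂_∞ Y → ∂_∞ X` induced by a rough isometry `φ`: the class of `(u n)` is sent to the
class of `(φ (u n))`. -/
def IsRoughIsometry.boundaryMap (h : IsRoughIsometry lam φ) :
    GromovBoundary Y → GromovBoundary X :=
  Quotient.map' (s₁ := gromovSetoid Y) (s₂ := gromovSetoid X)
    (fun u => ⟨fun n => φ (u.1 n), h.isGromovSeq u.2⟩)
    (fun u v huv o => by
      obtain ⟨c, hc⟩ := h.gromovProduct_le o (u.1 0)
      exact tendsto_atTop_mono (fun n => hc _ _)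
        (tendsto_atTop_add_const_right _ (-c) (huv (u.1 0))))

end RoughIsometry

/-! ### Rough starlikeness -/

/-- `X` is `K`-roughly starlike with respect to `ξ ∈ ∂_∞ X`: every point is within distance `K` of
a geodesic line joining `ξ` to some `ζ ∈ ∂_∞ X`. -/
def IsRoughlyStarlikeWith (X : Type*) [MetricSpace X] [GromovHyperbolicSpace X]
    (K : ℝ) (ξ : GromovBoundary X) : Prop :=
  ∀ x : X, ∃ ζ : GromovBoundary X, ∃ γ : ℝ → X, Isometry γ ∧
    RepresentsBoundary (fun n : ℕ => γ (-(n : ℝ))) ξ ∧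
    RepresentsBoundary (fun n : ℕ => γ (n : ℝ)) ζ ∧
    Metric.infDist x (range γ) ≤ K

/-- `X` is roughly starlike with respect to `ξ ∈ ∂_∞ X`. -/
def IsRoughlyStarlike (X : Type*) [MetricSpace X] [GromovHyperbolicSpace X]
    (ξ : GromovBoundary X) : Prop :=
  ∃ K : ℝ, 0 ≤ K ∧ IsRoughlyStarlikeWith X K ξ

/-! ### Uniform spaces -/

/-- The metric boundary `∂M = closure(M) \ M`, as a subset of the metric completion of `M`. -/
def metricBoundary (M : Type*) [MetricSpace M] : Set (UniformSpace.Completion M) :=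
  (range ((↑) : M → UniformSpace.Completion M))ᶜ

/-- The distance from a point of `M` to the metric boundary. -/
noncomputable def distToBoundary {M : Type*} [MetricSpace M] (z : M) : ℝ :=
  Metric.infDist (z : UniformSpace.Completion M) (metricBoundary M)

/-- `M` is an `A`-uniform metric space: it is locally compact and non-complete, and any two points
are joined by a rectifiable curve `γ` with `l(γ) ≤ A d(x, y)` such that
`min (l(γ[x, z])) (l(γ[z, y])) ≤ A d(z, ∂M)` for every `z` on `γ`. Length is `eVariationOn`. -/
def IsUniformMetricSpaceWith (M : Type*) [MetricSpace M] (A : ℝ) : Prop :=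
  LocallyCompactSpace M ∧ ¬ CompleteSpace M ∧
    ∀ x y : M, ∃ γ : Path x y,
      eVariationOn γ univ ≠ ⊤ ∧
      eVariationOn γ univ ≤ ENNReal.ofReal (A * dist x y) ∧
      ∀ t : unitInterval,
        min (eVariationOn γ (Iic t)) (eVariationOn γ (Ici t)) ≤
          ENNReal.ofReal (A * distToBoundary (γ t))

/-- `M` is a uniform metric space, i.e. `A`-uniform for some `A ≥ 1`. -/
def IsUniformMetricSpace (M : Type*) [MetricSpace M] : Prop :=
  ∃ A : ℝ, 1 ≤ A ∧ IsUniformMetricSpaceWith M A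

/-! ### Conformal deformations -/

/-- `γ` restricted to `[0, L]` is a rectifiable curve of length `L` from `x` to `y`, parametrized
by arclength. (Every rectifiable curve has such a parametrization.) -/
def IsArclengthCurve {X : Type*} [MetricSpace X] (γ : ℝ → X) (L : ℝ) (x y : X) : Prop :=
  0 ≤ L ∧ γ 0 = x ∧ γ L = y ∧ HasUnitSpeedOn γ (Icc 0 L)

/-- The deformed distance: the infimum of `∫_γ ρ ds` over the rectifiable curves `γ` from
`x` to `y`. -/
noncomputable def conformalDist {X : Type*} [MetricSpace X] (ρ : X → ℝ) (x y : X) : ℝ :=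
  sInf {r : ℝ | ∃ (γ : ℝ → X) (L : ℝ), IsArclengthCurve γ L x y ∧ r = ∫ t in (0 : ℝ)..L, ρ (γ t)}

section Curves

variable {X : Type*} [MetricSpace X] {γ γ' : ℝ → X} {L L' : ℝ} {x y z : X}

theorem hasUnitSpeedOn_Icc_iff {a b : ℝ} : HasUnitSpeedOn γ (Icc a b) ↔
    ∀ s t, a ≤ s → s ≤ t → t ≤ b → eVariationOn γ (Icc s t) = ENNReal.ofReal (t - s) := by
  unfold HasUnitSpeedOn
  rw [hasConstantSpeedOnWith_iff_ordered]
  constructor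
  · intro h s t hs hst ht
    have := h ⟨hs, hst.trans ht⟩ ⟨hs.trans hst, ht⟩ hst
    rwa [inter_eq_self_of_subset_right (Icc_subset_Icc hs ht), NNReal.coe_one, one_mul] at this
  · intro h s hs t ht hst
    rw [inter_eq_self_of_subset_right (Icc_subset_Icc hs.1 ht.2), NNReal.coe_one, one_mul]
    exact h s t hs.1 hst ht.2

theorem IsArclengthCurve.dist_le (h : IsArclengthCurve γ L x y) {s t : ℝ} (hs : 0 ≤ s)
    (hst : s ≤ t) (ht : t ≤ L) : dist (γ s) (γ t) ≤ t - s := by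
  have h1 := hasUnitSpeedOn_Icc_iff.1 h.2.2.2 s t hs hst ht
  have h2 := eVariationOn.edist_le γ (left_mem_Icc.2 hst) (right_mem_Icc.2 hst)
  rw [h1, edist_dist] at h2
  exact (ENNReal.ofReal_le_ofReal_iff (sub_nonneg.2 hst)).1 h2

theorem IsArclengthCurve.continuousOn (h : IsArclengthCurve γ L x y) :
    ContinuousOn γ (Icc 0 L) := by
  refine LipschitzOnWith.continuousOn (K := 1) (LipschitzOnWith.of_dist_le_mul fun s hs t ht => ?_)
  rw [NNReal.coe_one, one_mul, Real.dist_eq]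
  rcases le_total s t with hst | hst
  · rw [abs_sub_comm, abs_of_nonneg (sub_nonneg.2 hst)]
    exact h.dist_le hs.1 hst ht.2
  · rw [dist_comm, abs_of_nonneg (sub_nonneg.2 hst)]
    exact h.dist_le ht.1 hst hs.2

theorem IsArclengthCurve.intervalIntegrable (h : IsArclengthCurve γ L x y) {ρ : X → ℝ}
    (hρ : Continuous ρ) {a b : ℝ} (ha : a ∈ Icc 0 L) (hb : b ∈ Icc 0 L) :
    IntervalIntegrable (fun t => ρ (γ t)) MeasureTheory.volume a b :=
  ((hρ.comp_continuousOn h.continuousOn).mono (uIcc_subset_Icc ha hb)).intervalIntegrable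

theorem IsArclengthCurve.symm (h : IsArclengthCurve γ L x y) :
    IsArclengthCurve (fun t => γ (L - t)) L y x := by
  refine ⟨h.1, by simpa using h.2.2.1, by simpa using h.2.1, hasUnitSpeedOn_Icc_iff.2 ?_⟩
  intro s t hs hst ht
  have h1 := eVariationOn.comp_eq_of_antitoneOn γ (t := Icc s t) (fun t => L - t)
    (fun a _ b _ hab => sub_le_sub_left hab L)
  rw [image_const_sub_Icc] at h1
  rw [show (fun t => γ (L - t)) = γ ∘ fun t => L - t from rfl, h1,
    hasUnitSpeedOn_Icc_iff.1 h.2.2.2 _ _ (by linarith) (by linarith) (by linarith)]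
  congr 1; ring

theorem IsArclengthCurve.trans (h : IsArclengthCurve γ L x y) (h' : IsArclengthCurve γ' L' y z) :
    IsArclengthCurve (fun t => if t ≤ L then γ t else γ' (t - L)) (L + L') x z := by
  have e1 : ∀ t, t ≤ L → (fun t => if t ≤ L then γ t else γ' (t - L)) t = γ t :=
    fun t ht => if_pos ht
  have e2 : ∀ t, L ≤ t → (fun t => if t ≤ L then γ t else γ' (t - L)) t = γ' (t - L) := by
    intro t ht
    rcases ht.eq_or_lt with rfl | ht
    · simp [h.2.2.1, h'.2.1]
    · exact if_neg ht.not_ge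
  refine ⟨add_nonneg h.1 h'.1, ?_, ?_, ?_⟩
  · rw [e1 0 h.1]; exact h.2.1
  · rw [e2 _ (by linarith [h'.1]), add_sub_cancel_left]; exact h'.2.2.1
  · refine HasUnitSpeedOn.Icc_Icc (y := L) (hasUnitSpeedOn_Icc_iff.2 ?_)
      (hasUnitSpeedOn_Icc_iff.2 ?_)
    · intro s t hs hst ht
      rw [eVariationOn.congr (fun a ha => e1 a (ha.2.trans ht) : EqOn _ γ (Icc s t))]
      exact hasUnitSpeedOn_Icc_iff.1 h.2.2.2 s t hs hst ht
    · intro s t hs hst ht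
      rw [eVariationOn.congr
        (fun a ha => e2 a (hs.trans ha.1) : EqOn _ (γ' ∘ fun t => t - L) (Icc s t)),
        show (fun a => γ' (a - L)) = γ' ∘ fun t => t - L from rfl,
        eVariationOn.comp_eq_of_monotoneOn γ' (fun t => t - L)
          (fun a _ b _ hab => by simpa using hab), image_sub_const_Icc,
        hasUnitSpeedOn_Icc_iff.1 h'.2.2.2 _ _ (by linarith) (by linarith) (by linarith)]
      congr 1; ring

theorem exists_isArclengthCurve [GeodesicSpace X] (x y : X) :
    ∃ (γ : ℝ → X), IsArclengthCurve γ (dist x y) x y := by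
  obtain ⟨γ, h0, h1, hγ⟩ := GeodesicSpace.exists_geodesic x y
  refine ⟨γ, dist_nonneg, h0, h1, hasUnitSpeedOn_Icc_iff.2 fun s t hs hst ht => ?_⟩
  have : eVariationOn γ (Icc s t) = eVariationOn (id : ℝ → ℝ) (Icc s t) := by
    unfold eVariationOn
    refine iSup_congr fun p => Finset.sum_congr rfl fun i _ => ?_
    have hm : ∀ j, p.2.1 j ∈ Icc 0 (dist x y) := fun j =>
      Icc_subset_Icc hs ht (p.2.2.2 j)
    rw [edist_dist, edist_dist, hγ _ (hm _) _ (hm _), Real.dist_eq, id, id]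
  have h2 := (monotone_id.monotoneOn (Icc s t)).eVariationOn_eq (left_mem_Icc.2 hst)
    (right_mem_Icc.2 hst)
  rw [inter_self] at h2
  rw [this, h2, id, id]

variable {ρ : X → ℝ}

theorem conformalDist_le (hρ0 : ∀ x, 0 < ρ x) (h : IsArclengthCurve γ L x y) :
    conformalDist ρ x y ≤ ∫ t in (0 : ℝ)..L, ρ (γ t) := by
  refine csInf_le ⟨0, ?_⟩ ⟨γ, L, h, rfl⟩
  rintro r ⟨γ, L, h, rfl⟩
  exact intervalIntegral.integral_nonneg h.1 fun t _ => (hρ0 _).le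

theorem le_conformalDist [GeodesicSpace X] {c : ℝ}
    (hc : ∀ (γ : ℝ → X) (L : ℝ), IsArclengthCurve γ L x y → c ≤ ∫ t in (0 : ℝ)..L, ρ (γ t)) :
    c ≤ conformalDist ρ x y := by
  obtain ⟨γ, hγ⟩ := exists_isArclengthCurve x y
  refine le_csInf ⟨_, γ, _, hγ, rfl⟩ ?_
  rintro r ⟨γ, L, h, rfl⟩
  exact hc γ L h

theorem conformalDist_self (hρ0 : ∀ x, 0 < ρ x) [GeodesicSpace X] (x : X) :
    conformalDist ρ x x = 0 := by
  refine le_antisymm ?_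
    (le_conformalDist fun γ L h => intervalIntegral.integral_nonneg h.1 fun t _ => (hρ0 _).le)
  obtain ⟨γ, hγ⟩ := exists_isArclengthCurve x x
  simpa using conformalDist_le hρ0 hγ

theorem conformalDist_comm_le (hρ0 : ∀ x, 0 < ρ x) [GeodesicSpace X] (x y : X) :
    conformalDist ρ x y ≤ conformalDist ρ y x := by
  refine le_conformalDist fun γ L h => (conformalDist_le hρ0 h.symm).trans_eq ?_
  simpa using intervalIntegral.integral_comp_sub_left (a := 0) (b := L) (fun t => ρ (γ t)) L

theorem conformalDist_triangle (hρ : Continuous ρ) (hρ0 : ∀ x, 0 < ρ x) [GeodesicSpace X]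
    (x y z : X) : conformalDist ρ x z ≤ conformalDist ρ x y + conformalDist ρ y z := by
  rw [← sub_le_iff_le_add']
  refine le_conformalDist fun γ' L' h' => ?_
  rw [sub_le_iff_le_add, ← sub_le_iff_le_add']
  refine le_conformalDist fun γ L h => ?_
  rw [sub_le_iff_le_add']
  refine (conformalDist_le hρ0 (h.trans h')).trans_eq ?_
  have hL := h.1
  have hL' := h'.1
  rw [← intervalIntegral.integral_add_adjacent_intervals (b := L)
    ((h.trans h').intervalIntegrable hρ ⟨le_rfl, by linarith⟩ ⟨hL, by linarith⟩)
    ((h.trans h').intervalIntegrable hρ ⟨hL, by linarith⟩ ⟨by linarith, le_rfl⟩), add_comm]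
  congr 1
  · have := intervalIntegral.integral_comp_sub_right (a := L) (b := L + L') (fun t => ρ (γ' t)) L
    rw [sub_self, add_sub_cancel_left] at this
    rw [← this]
    refine intervalIntegral.integral_congr fun t ht => ?_
    rw [uIcc_of_le (by linarith)] at ht
    rcases ht.1.eq_or_lt with rfl | hlt
    · simp [h.2.2.1, h'.2.1]
    · simp [hlt.not_ge]
  · refine intervalIntegral.integral_congr fun t ht => ?_
    rw [uIcc_of_le hL] at ht
    simp [ht.2]

theorem conformalDist_pos (hρ : Continuous ρ) (hρ0 : ∀ x, 0 < ρ x) [GeodesicSpace X]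
    (hxy : x ≠ y) : 0 < conformalDist ρ x y := by
  obtain ⟨r, hr, hball⟩ := Metric.eventually_nhds_iff.1
    (hρ.continuousAt.eventually (lt_mem_nhds (half_lt_self (hρ0 x))))
  have hd := dist_pos.2 hxy
  set a := min (r / 2) (dist x y) with ha
  have ha0 : 0 < a := lt_min (half_pos hr) hd
  refine (mul_pos ha0 (half_pos (hρ0 x))).trans_le (le_conformalDist fun γ L h => ?_)
  have hL : a ≤ L := by
    have := h.dist_le le_rfl h.1 le_rfl
    rw [h.2.1, h.2.2.1, sub_zero] at this
    exact (min_le_right _ _).trans this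
  have i1 := h.intervalIntegrable hρ (left_mem_Icc.2 h.1) ⟨ha0.le, hL⟩
  have i2 := h.intervalIntegrable hρ ⟨ha0.le, hL⟩ (right_mem_Icc.2 h.1)
  rw [← intervalIntegral.integral_add_adjacent_intervals i1 i2]
  have h2 : 0 ≤ ∫ t in a..L, ρ (γ t) :=
    intervalIntegral.integral_nonneg hL fun t _ => (hρ0 _).le
  have h1 : ∫ _ in (0 : ℝ)..a, ρ x / 2 ≤ ∫ t in (0 : ℝ)..a, ρ (γ t) := by
    refine intervalIntegral.integral_mono_on ha0.le (by simp) i1 fun t ht => (hball ?_).le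
    have h3 := h.dist_le le_rfl ht.1 (ht.2.trans hL)
    rw [h.2.1, sub_zero] at h3
    rw [dist_comm]
    linarith [ht.2, min_le_left (r / 2) (dist x y)]
  simp only [intervalIntegral.integral_const, sub_zero, smul_eq_mul] at h1
  linarith

end Curves

/-- The metric `d_ρ` on a geodesic space `X`, for a continuous positive density `ρ`. -/
noncomputable abbrev conformalMetric {X : Type*} [MetricSpace X] [GeodesicSpace X] (ρ : X → ℝ)
    (hρ : Continuous ρ) (hρ0 : ∀ x, 0 < ρ x) : MetricSpace X where
  dist := conformalDist ρ
  dist_self := conformalDist_self hρ0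
  dist_comm x y := le_antisymm (conformalDist_comm_le hρ0 x y) (conformalDist_comm_le hρ0 y x)
  dist_triangle := conformalDist_triangle hρ hρ0
  eq_of_dist_eq_zero {x y} h := by
    by_contra hxy
    exact (conformalDist_pos hρ hρ0 hxy).ne' h

/-- The density `ρ_ε(x) = exp (-ε b_{ξ,o}(x))`. -/
noncomputable def busemannDensity {X : Type*} [MetricSpace X] [GromovHyperbolicSpace X]
    (ξ : GromovBoundary X) (o : X) (ε : ℝ) (x : X) : ℝ :=
  Real.exp (-ε * busemann ξ o x)

theorem continuous_busemannDensity {X : Type*} [MetricSpace X] [GromovHyperbolicSpace X]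
    (ξ : GromovBoundary X) (o : X) (ε : ℝ) : Continuous (busemannDensity ξ o ε) :=
  Real.continuous_exp.comp (continuous_const.mul (continuous_busemann ξ o))

/-- The conformal deformation `X_ε`: the set `X`, to be equipped with the metric `d_ε` (see the
instance below) generated by the density `exp (-ε b_{ξ,o})`. -/
def BusemannDeformation (X : Type*) [MetricSpace X] [GromovHyperbolicSpace X]
    (_ξ : GromovBoundary X) (_o : X) (_ε : ℝ) : Type _ := X

noncomputable instance BusemannDeformation.instMetricSpace (X : Type*) [MetricSpace X]
    [GromovHyperbolicSpace X] [GeodesicSpace X] (ξ : GromovBoundary X) (o : X) (ε : ℝ) :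
    MetricSpace (BusemannDeformation X ξ o ε) :=
  conformalMetric (X := X) (busemannDensity ξ o ε) (continuous_busemannDensity ξ o ε)
    (fun _ => Real.exp_pos _)

/-! The deformed metric matters only at unit scale of the original metric. Busemann functions are
2-Lipschitz, so the density `ρ` satisfies a Harnack inequality; a unit step from `p` then costs
about `ρ p`, and the length of a curve is comparable to the sum of the densities along a chain of
unit steps. `IsConformalChange` isolates these bounds. Hyperbolicity enters only through Busemann
functions: up to a bounded error `busemann ξ o x` is `dist x (u n) - dist o (u n)` for late `n`, so
`φ` carries one Busemann function to the other within a constant, and the densities `ρ ∘ φ` and `σ`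
are comparable.

Nearby points of `Y` are joined by a geodesic. For points `p`, `q` far apart, take a uniform curve
in `X_ε` from `φ p` to `φ q`, cut it into unit steps of `X`, replace each cut point by a nearby
image point `φ (y i)`, and join consecutive `y i` by geodesics of `Y`. The sums of densities over
this chain are controlled by lengths of the uniform curve, and `exists_path_of_chain` turns them
back into lengths in `Y_ε`.

Three comparisons close the argument. The length bound needs `d_ε(φ p, φ q) ≲ d_ε(p, q)` for points
at distance at least 1 (`exists_dist_le_conformalDist`, by discretising curves in `Y`). The cone
condition in `X_ε` must bound partial sums by the density, so the distance to the boundary must be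
at most a multiple of `ρ`: this is where rough starlikeness is used, since a line leaving `ω'` has
geometrically decaying density and so reaches the boundary in finite length. In `Y_ε` only the
reverse bound is needed, and it follows from properness alone (`le_distToBoundary`). Pulling such a
ray back to `Y` gives incompleteness. -/

/-! ### Busemann functions along Gromov sequences -/

section BusemannLimit

variable {X : Type*} [MetricSpace X] [GromovHyperbolicSpace X]

/-- Late terms of equivalent sequences have mutual product at least `dist x o`, which dominates the
product of `x` with `u m`. The minimum in the four-point condition is then attained by the latter.
-/
theorem exists_gromovProduct_sub_le {δ : ℝ}
    (hδ : ∀ x y z o : X, min (gromovProduct o x z) (gromovProduct o z y) - δ ≤ gromovProduct o x y)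
    {u v : GromovSeq X} (huv : u.toBoundary = v.toBoundary) (o x : X) :
    ∃ N, ∀ m n, N ≤ m → N ≤ n →
      gromovProduct o x (u.1 m) - δ ≤ gromovProduct o x (v.1 n) := by
  have h1 : ∀ᶠ p : ℕ × ℕ in atTop, dist x o + δ ≤ gromovProduct o (u.1 p.1) (u.1 p.2) :=
    tendsto_atTop.1 (u.2 o) _
  have h2 : ∀ᶠ p : ℕ × ℕ in atTop, dist x o + δ ≤ gromovProduct o (u.1 p.2) (v.1 p.2) := by
    rw [← prod_atTop_atTop_eq]
    exact tendsto_snd.eventually (tendsto_atTop.1 (Quotient.exact huv o) _)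
  obtain ⟨N, hN⟩ := eventually_atTop_prod_self.1 (h1.and h2)
  refine ⟨N, fun m n hm hn => ?_⟩
  obtain ⟨h3, h4⟩ := hN m n hm hn
  have h5 := hδ (u.1 m) (v.1 n) (u.1 n) o
  have h6 := hδ x (v.1 n) (u.1 m) o
  have h7 := le_min h3 h4
  have h8 := gromovProduct_le_right o x (u.1 m)
  rw [min_eq_left (by linarith)] at h6
  exact h6

/-- The threshold for comparing `u` with a competitor `v` depends on `v`. Passing first to a late
term of `u` itself removes this dependence at the price of a second `δ` in the lower bound. The
upper bound uses `u` as its own competitor and costs one `δ`. -/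
theorem RepresentsBoundary.eventually_gromovProduct {δ : ℝ}
    (hδ : ∀ x y z o : X, min (gromovProduct o x z) (gromovProduct o z y) - δ ≤ gromovProduct o x y)
    {u : ℕ → X} {ξ : GromovBoundary X} (hu : RepresentsBoundary u ξ) (o x : X) :
    ∀ᶠ n in atTop, gromovProduct o x (u n) - 2 * δ ≤ gromovProductBoundary o x ξ ∧
      gromovProductBoundary o x ξ ≤ gromovProduct o x (u n) + δ := by
  obtain ⟨hu, rfl⟩ := hu
  obtain ⟨N, hN⟩ := exists_gromovProduct_sub_le hδ
    (rfl : GromovSeq.toBoundary (⟨u, hu⟩ : GromovSeq X) = _) o x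
  have hb : ∀ v : ℕ → X, IsBoundedUnder (· ≥ ·) atTop (fun n : ℕ => gromovProduct o x (v n)) :=
    fun v => isBoundedUnder_of ⟨0, fun n => gromovProduct_nonneg _ _ _⟩
  have hb' : ∀ v : ℕ → X, IsCoboundedUnder (· ≥ ·) atTop (fun n : ℕ => gromovProduct o x (v n)) :=
    fun v => (isBoundedUnder_of (r := (· ≤ ·))
      ⟨dist x o, fun n => gromovProduct_le_right _ _ _⟩).isCoboundedUnder_ge
  filter_upwards [eventually_ge_atTop N] with n hn
  constructor
  · refine le_ciInf fun v => ?_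
    obtain ⟨N', hN'⟩ := exists_gromovProduct_sub_le hδ v.2.symm o x
    refine le_liminf_of_le (hb' _) ?_
    filter_upwards [eventually_ge_atTop N'] with m hm
    have h1 := hN' (max N N') m (le_max_right _ _) hm
    have h2 := hN n (max N N') hn (le_max_left _ _)
    simp only at h1 h2
    linarith
  · refine (ciInf_le ⟨0, ?_⟩ ⟨⟨u, hu⟩, rfl⟩).trans (liminf_le_of_frequently_le ?_ (hb _))
    · rintro _ ⟨v, rfl⟩
      exact le_liminf_of_le (hb' _) (Eventually.of_forall fun n => gromovProduct_nonneg _ _ _)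
    · refine Eventually.frequently ?_
      filter_upwards [eventually_ge_atTop N] with m hm
      have := hN m n hm hn
      simp only at this
      linarith

/-- The Busemann function based at `ξ` is, up to an additive constant, the limit of
`d(x, u n) - d(o, u n)` along any Gromov sequence `u` in the class `ξ`. -/
theorem exists_eventually_abs_busemann_sub_le (X : Type*) [MetricSpace X]
    [GromovHyperbolicSpace X] : ∃ C : ℝ, 0 ≤ C ∧
      ∀ (ξ : GromovBoundary X) (u : ℕ → X), RepresentsBoundary u ξ → ∀ o x : X,
        ∀ᶠ n in atTop, |busemann ξ o x - (dist x (u n) - dist o (u n))| ≤ C := by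
  obtain ⟨δ, hδ0, hδ⟩ := GromovHyperbolicSpace.exists_delta (X := X)
  -- The Busemann function is a difference of two boundary products, each off by at most `2 * δ` on
  -- one side and `δ` on the other.
  refine ⟨3 * δ, by positivity, fun ξ u hu o x => ?_⟩
  filter_upwards [hu.eventually_gromovProduct hδ o x, hu.eventually_gromovProduct hδ x o]
    with n h1 h2
  have h3 : gromovProduct x o (u n) - gromovProduct o x (u n) = dist x (u n) - dist o (u n) := by
    unfold gromovProduct
    rw [dist_comm o x, dist_comm (u n) x, dist_comm (u n) o]; ring
  unfold busemann
  rw [abs_le]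
  constructor <;> linarith

/-- Along a geodesic line issuing from `ξ`, the Busemann function grows at unit rate. -/
theorem exists_busemann_line_le (X : Type*) [MetricSpace X] [GromovHyperbolicSpace X] :
    ∃ C : ℝ, ∀ (ξ : GromovBoundary X) (o : X) (γ : ℝ → X), Isometry γ →
      RepresentsBoundary (fun n : ℕ => γ (-(n : ℝ))) ξ → ∀ s t, s ≤ t →
        busemann ξ o (γ s) + (t - s) ≤ busemann ξ o (γ t) + C := by
  obtain ⟨C, -, hC⟩ := exists_eventually_abs_busemann_sub_le X
  refine ⟨2 * C, fun ξ o γ hγ hξ s t hst => ?_⟩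
  -- Requiring `-n ≤ s` puts `γ (-n)` before both points, so the distances to it are `s + n` and `t
  -- + n`.
  obtain ⟨n, hs, ht, hn⟩ := ((hC ξ _ hξ o (γ s)).and ((hC ξ _ hξ o (γ t)).and
    (tendsto_natCast_atTop_atTop.eventually_ge_atTop (-s)))).exists
  rw [hγ.dist_eq, Real.dist_eq, abs_of_nonneg (a := s - -(n : ℝ)) (by linarith), abs_le] at hs
  rw [hγ.dist_eq, Real.dist_eq, abs_of_nonneg (a := t - -(n : ℝ)) (by linarith), abs_le] at ht
  linarith [hs.2, ht.1]

/-- Rough isometries preserve Busemann functions up to an additive constant. -/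
theorem IsRoughIsometry.exists_abs_busemann_sub_le {Y : Type*} [MetricSpace Y]
    [GromovHyperbolicSpace Y] {lam : ℝ} {φ : Y → X} (hφ : IsRoughIsometry lam φ)
    (ω : GromovBoundary Y) (o : Y) (o' : X) :
    ∃ C : ℝ, 0 ≤ C ∧
      ∀ y, |busemann (hφ.boundaryMap ω) o' (φ y) - busemann ω o y| ≤ C := by
  obtain ⟨C₁, h₁, hC₁⟩ := exists_eventually_abs_busemann_sub_le X
  obtain ⟨C₂, h₂, hC₂⟩ := exists_eventually_abs_busemann_sub_le Y
  obtain ⟨u, rfl⟩ : ∃ u : GromovSeq Y, u.toBoundary = ω := Quotient.exists_rep ω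
  have hlam : 0 ≤ lam := by
    have h3 := (hφ.1 o o).1
    have h4 := (hφ.1 o o).2
    linarith
  refine ⟨C₁ + C₂ + 2 * lam + dist (φ o) o', by positivity, fun y => ?_⟩
  have hr : RepresentsBoundary (fun n => φ (u.1 n)) (hφ.boundaryMap u.toBoundary) :=
    ⟨hφ.isGromovSeq u.2, rfl⟩
  obtain ⟨n, hx, hy⟩ := ((hC₁ _ _ hr o' (φ y)).and (hC₂ u.toBoundary u.1 ⟨u.2, rfl⟩ o y)).exists
  have h1 := hφ.1 y (u.1 n)
  have h2 := hφ.1 o (u.1 n)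
  have h3 := dist_triangle (φ o) o' (φ (u.1 n))
  have h4 := dist_triangle_left o' (φ (u.1 n)) (φ o)
  rw [abs_le] at hx hy ⊢
  obtain ⟨hx1, hx2⟩ := hx
  obtain ⟨hy1, hy2⟩ := hy
  constructor <;> linarith [h1.1, h1.2, h2.1, h2.2]

end BusemannLimit

/-! ### Metrics comparable with a density at unit scale -/

/-- The bijection `e` replaces the metric of `W` by one that is comparable with `ρ · d_W` at unit
scale, for a density `ρ` satisfying a Harnack inequality. -/
structure IsConformalChange {W W' : Type*} [MetricSpace W] [MetricSpace W'] (e : W ≃ W')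
    (ρ : W → ℝ) (κ : ℝ) : Prop where
  nonneg : 0 ≤ κ
  pos : ∀ p, 0 < ρ p
  harnack : ∀ p q, ρ q ≤ Real.exp (κ * dist p q) * ρ p
  lower : ∀ p q, Real.exp (-κ) * ρ p * min 1 (dist p q) ≤ dist (e p) (e q)
  upper : ∀ p q, dist (e p) (e q) ≤ Real.exp (κ * dist p q) * ρ p * dist p q

/-- The identity map from `X` to its conformal deformation. -/
def BusemannDeformation.of {X : Type*} [MetricSpace X] [GromovHyperbolicSpace X]
    (ξ : GromovBoundary X) (o : X) (ε : ℝ) : X ≃ BusemannDeformation X ξ o ε :=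
  Equiv.refl X

/-- The rate `2 * ε` comes from the Lipschitz constant 2 of the Busemann function. The upper bound
integrates along a geodesic. -/
theorem BusemannDeformation.isConformalChange (X : Type*) [MetricSpace X] [GromovHyperbolicSpace X]
    [GeodesicSpace X] (ξ : GromovBoundary X) (o : X) {ε : ℝ} (hε : 0 < ε) :
    IsConformalChange (BusemannDeformation.of ξ o ε) (busemannDensity ξ o ε) (2 * ε) := by
  have hpos : ∀ p, 0 < busemannDensity ξ o ε p := fun p => Real.exp_pos _
  have har : ∀ p q, busemannDensity ξ o ε q ≤
      Real.exp (2 * ε * dist p q) * busemannDensity ξ o ε p := by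
    intro p q
    unfold busemannDensity
    rw [← Real.exp_add, Real.exp_le_exp]
    nlinarith [busemann_le ξ o p q]
  have hcont := continuous_busemannDensity ξ o ε
  refine ⟨by positivity, hpos, har, fun p q => ?_, fun p q => ?_⟩
  · change _ ≤ conformalDist (busemannDensity ξ o ε) p q
    refine le_conformalDist fun γ L h => ?_
    -- Every curve has length at least `a`; its initial stretch of length `a` stays within distance
    -- 1 of `p`, where the density is at least `exp (-2ε)` times that at `p`.
    set a := min 1 (dist p q) with ha
    have ha0 : 0 ≤ a := le_min zero_le_one dist_nonneg
    have hL : a ≤ L := by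
      have := h.dist_le le_rfl h.1 le_rfl
      rw [h.2.1, h.2.2.1, sub_zero] at this
      exact (min_le_right _ _).trans this
    have i1 := h.intervalIntegrable hcont (left_mem_Icc.2 h.1) ⟨ha0, hL⟩
    have i2 := h.intervalIntegrable hcont ⟨ha0, hL⟩ (right_mem_Icc.2 h.1)
    rw [← intervalIntegral.integral_add_adjacent_intervals i1 i2]
    have h2 : 0 ≤ ∫ t in a..L, busemannDensity ξ o ε (γ t) :=
      intervalIntegral.integral_nonneg hL fun t _ => (hpos _).le
    have h1 : ∫ _ in (0 : ℝ)..a, Real.exp (-(2 * ε)) * busemannDensity ξ o ε p ≤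
        ∫ t in (0 : ℝ)..a, busemannDensity ξ o ε (γ t) := by
      refine intervalIntegral.integral_mono_on ha0 (by simp) i1 fun t ht => ?_
      have h3 := h.dist_le le_rfl ht.1 (ht.2.trans hL)
      rw [h.2.1, sub_zero] at h3
      rw [Real.exp_neg, inv_mul_le_iff₀ (Real.exp_pos _)]
      refine (har (γ t) p).trans ?_
      refine mul_le_mul_of_nonneg_right (Real.exp_le_exp.2 ?_) (hpos _).le
      rw [dist_comm]
      nlinarith [ht.2, min_le_left 1 (dist p q)]
    simp only [intervalIntegral.integral_const, sub_zero, smul_eq_mul] at h1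
    linarith
  · obtain ⟨γ, h⟩ := exists_isArclengthCurve p q
    change conformalDist (busemannDensity ξ o ε) p q ≤ _
    refine (conformalDist_le hpos h).trans ?_
    have h1 : ∫ t in (0 : ℝ)..dist p q, busemannDensity ξ o ε (γ t) ≤
        ∫ _ in (0 : ℝ)..dist p q, Real.exp (2 * ε * dist p q) * busemannDensity ξ o ε p := by
      refine intervalIntegral.integral_mono_on dist_nonneg
        (h.intervalIntegrable hcont (left_mem_Icc.2 h.1) (right_mem_Icc.2 h.1)) (by simp)
        fun t ht => ?_
      have h3 := h.dist_le le_rfl ht.1 ht.2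
      rw [h.2.1, sub_zero] at h3
      refine (har p (γ t)).trans ?_
      gcongr
      · exact (hpos _).le
      · linarith [ht.2]
    simp only [intervalIntegral.integral_const, sub_zero, smul_eq_mul] at h1
    linarith

/-! ### Topology and boundary of a conformally changed space -/

namespace IsConformalChange

variable {W W' : Type*} [MetricSpace W] [MetricSpace W'] {e : W ≃ W'} {ρ : W → ℝ} {κ : ℝ}

theorem harnack_of_le (h : IsConformalChange e ρ κ) {p q : W} {M : ℝ} (hM : dist p q ≤ M) :
    ρ q ≤ Real.exp (κ * M) * ρ p := by
  refine (h.harnack p q).trans ?_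
  have := h.nonneg
  have := (h.pos p).le
  gcongr

theorem continuous (h : IsConformalChange e ρ κ) : Continuous e := by
  rw [continuous_iff_continuousAt]
  intro p
  rw [ContinuousAt, tendsto_iff_dist_tendsto_zero]
  have hd : Tendsto (fun q => dist p q) (𝓝 p) (𝓝 0) := by
    simpa using (continuous_const.dist continuous_id : Continuous fun q => dist p q).tendsto p
  have h1 : Tendsto (fun q => Real.exp (κ * dist p q) * ρ p * dist p q) (𝓝 p) (𝓝 0) := by
    have := (((Real.continuous_exp.tendsto _).comp (hd.const_mul κ)).mul_const (ρ p)).mul hd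
    simpa using this
  refine squeeze_zero (fun _ => dist_nonneg) (fun q => ?_) h1
  rw [dist_comm]
  exact h.upper p q

theorem dist_lt_of_dist_lt (h : IsConformalChange e ρ κ) {p q : W} {r : ℝ} (hr : r ≤ 1)
    (hpq : dist (e p) (e q) < Real.exp (-κ) * ρ p * r) : dist p q < r := by
  have h1 := (h.lower p q).trans_lt hpq
  have h2 := lt_of_mul_lt_mul_left h1 (mul_pos (Real.exp_pos _) (h.pos p)).le
  rcases min_lt_iff.1 h2 with h3 | h3
  · exact absurd h3 hr.not_gt
  · exact h3

theorem continuous_symm (h : IsConformalChange e ρ κ) : Continuous e.symm := by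
  rw [Metric.continuous_iff]
  intro b r hr
  refine ⟨Real.exp (-κ) * ρ (e.symm b) * min 1 r, by have := h.pos (e.symm b); positivity,
    fun a hab => ?_⟩
  rw [dist_comm]
  refine (h.dist_lt_of_dist_lt (min_le_left _ _) ?_).trans_le (min_le_right 1 r)
  simpa [dist_comm] using hab

/-- `e` as a homeomorphism. -/
def toHomeomorph (h : IsConformalChange e ρ κ) : W ≃ₜ W' where
  toEquiv := e
  continuous_toFun := h.continuous
  continuous_invFun := h.continuous_symm

theorem locallyCompactSpace [LocallyCompactSpace W] (h : IsConformalChange e ρ κ) :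
    LocallyCompactSpace W' :=
  h.toHomeomorph.locallyCompactSpace_iff.1 inferInstance

/-- A closed unit ball of `W` is compact, so its image is closed in the completion. A completion
point closer to `e z` than the bound is a limit of points of that image, hence not a boundary point.
-/
theorem le_distToBoundary [ProperSpace W] (h : IsConformalChange e ρ κ)
    (hne : (metricBoundary W').Nonempty) (z : W) :
    Real.exp (-κ) * ρ z ≤ distToBoundary (e z) := by
  refine (Metric.le_infDist hne).2 fun p hp => ?_
  by_contra! hlt
  refine hp ?_
  have hcl : IsClosed (((↑) : W' → UniformSpace.Completion W') '' (e '' Metric.closedBall z 1)) :=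
    (((isCompact_closedBall z 1).image h.continuous).image
      (UniformSpace.Completion.continuous_coe W')).isClosed
  suffices hp' : p ∈ closure
      (((↑) : W' → UniformSpace.Completion W') '' (e '' Metric.closedBall z 1)) by
    rw [hcl.closure_eq] at hp'
    exact image_subset_range _ _ hp'
  rw [mem_closure_iff_nhds]
  intro U hU
  have hV : Metric.ball (e z : UniformSpace.Completion W') (Real.exp (-κ) * ρ z) ∈ 𝓝 p :=
    Metric.isOpen_ball.mem_nhds (by rwa [Metric.mem_ball, dist_comm])
  obtain ⟨w, hwU, w, rfl⟩ := mem_closure_iff_nhds.1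
    (UniformSpace.Completion.denseRange_coe p) _ (inter_mem hU hV)
  refine ⟨w, hwU.1, w, ⟨e.symm w, ?_, e.apply_symm_apply w⟩, rfl⟩
  have h1 := hwU.2
  rw [Metric.mem_ball, UniformSpace.Completion.dist_eq, dist_comm] at h1
  rw [Metric.mem_closedBall, dist_comm]
  exact (h.dist_lt_of_dist_lt le_rfl (by simpa using h1)).le

/-- A sequence with bounded steps along which the density decays geometrically converges to a
boundary point. -/
theorem exists_mem_metricBoundary (h : IsConformalChange e ρ κ) {p : ℕ → W} {M B θ : ℝ}
    (hθ0 : 0 ≤ θ) (hθ : θ < 1) (hM : ∀ n, dist (p n) (p (n + 1)) ≤ M)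
    (hB : ∀ n, ρ (p n) ≤ B * θ ^ n) :
    ∃ w ∈ metricBoundary W',
      dist (e (p 0) : UniformSpace.Completion W') w ≤ Real.exp (κ * M) * M * B / (1 - θ) := by
  have hM0 : 0 ≤ M := dist_nonneg.trans (hM 0)
  have hk := h.nonneg
  have hstep : ∀ n, dist (e (p n) : UniformSpace.Completion W') (e (p (n + 1))) ≤
      Real.exp (κ * M) * M * B * θ ^ n := by
    intro n
    rw [UniformSpace.Completion.dist_eq]
    have h0 := (h.pos (p n)).le
    calc dist (e (p n)) (e (p (n + 1)))
        ≤ Real.exp (κ * dist (p n) (p (n + 1))) * ρ (p n) * dist (p n) (p (n + 1)) := h.upper _ _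
      _ ≤ Real.exp (κ * M) * ρ (p n) * M := by
          have := hM n
          gcongr
      _ ≤ Real.exp (κ * M) * (B * θ ^ n) * M := by
          have := hB n
          gcongr
      _ = _ := by ring
  obtain ⟨w, hw⟩ := cauchySeq_tendsto_of_complete (cauchySeq_of_le_geometric θ _ hθ hstep)
  refine ⟨w, ?_, dist_le_of_le_geometric_of_tendsto₀ θ _ hθ hstep hw⟩
  -- If the limit were a point of `W'`, the sequence would converge in `W` as well, and Harnack
  -- would force the density at the limit to be 0.
  rintro ⟨q, rfl⟩
  have h1 : Tendsto (fun n => e (p n)) atTop (𝓝 q) :=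
    (UniformSpace.Completion.isUniformEmbedding_coe W').isEmbedding.tendsto_nhds_iff.2 hw
  have h2 : Tendsto p atTop (𝓝 (e.symm q)) := by
    simpa [Function.comp_def] using (h.continuous_symm.tendsto q).comp h1
  have h3 : ∀ᶠ n in atTop, dist (p n) (e.symm q) < 1 :=
    (tendsto_iff_dist_tendsto_zero.1 h2).eventually_lt_const one_pos
  have h4 : Tendsto (fun n : ℕ => Real.exp (κ * 1) * (B * θ ^ n)) atTop (𝓝 0) := by
    simpa using ((tendsto_pow_atTop_nhds_zero_of_lt_one hθ0 hθ).const_mul B).const_mul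
      (Real.exp (κ * 1))
  obtain ⟨n, h5, h6⟩ := (h3.and (h4.eventually_lt_const (h.pos (e.symm q)))).exists
  have h7 := h.harnack_of_le h5.le
  have h8 := mul_le_mul_of_nonneg_left (hB n) (Real.exp_pos (κ * 1)).le
  linarith

end IsConformalChange

theorem not_completeSpace_of_nonempty_metricBoundary {M : Type*} [MetricSpace M]
    (h : (metricBoundary M).Nonempty) : ¬ CompleteSpace M := by
  intro hc
  obtain ⟨p, hp⟩ := h
  have h1 : IsClosed (range ((↑) : M → UniformSpace.Completion M)) :=
    (UniformSpace.Completion.isUniformEmbedding_coe M).isUniformInducing.isComplete_range.isClosed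
  exact hp (h1.closure_eq ▸ UniformSpace.Completion.denseRange_coe p)

/-! ### Curves along chains of points -/

section PiecewiseLipschitz

variable {Z : Type*} [PseudoMetricSpace Z] {f : ℝ → Z}

theorem eVariationOn_Icc_le_of_dist_le {a b c : ℝ} (hab : a ≤ b) (hc : 0 ≤ c)
    (hf : ∀ s ∈ Icc a b, ∀ t ∈ Icc a b, dist (f s) (f t) ≤ c * |s - t|) :
    eVariationOn f (Icc a b) ≤ ENNReal.ofReal (c * (b - a)) := by
  have h1 : LipschitzOnWith c.toNNReal f (Icc a b) :=
    LipschitzOnWith.of_dist_le_mul fun s hs t ht => by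
      rw [Real.coe_toNNReal _ hc, Real.dist_eq]
      exact hf s hs t ht
  have h2 := h1.comp_eVariationOn_le (g := id) (mapsTo_id _)
  have h3 := (monotone_id.monotoneOn (Icc a b)).eVariationOn_eq (left_mem_Icc.2 hab)
    (right_mem_Icc.2 hab)
  rw [inter_self] at h3
  rw [h3] at h2
  rwa [ENNReal.ofReal_mul hc]

variable {a : ℕ → ℝ}

theorem eVariationOn_Icc_le_sum (ha : ∀ i, 0 ≤ a i)
    (hf : ∀ i : ℕ, ∀ s ∈ Icc (i : ℝ) (i + 1), ∀ t ∈ Icc (i : ℝ) (i + 1),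
      dist (f s) (f t) ≤ a i * |s - t|) {j k : ℕ} (hjk : j ≤ k) :
    eVariationOn f (Icc (j : ℝ) k) ≤ ENNReal.ofReal (∑ i ∈ Finset.Ico j k, a i) := by
  induction k, hjk using Nat.le_induction with
  | base => simp [eVariationOn.subsingleton]
  | succ k hjk ih =>
    have h1 := eVariationOn.Icc_add_Icc f (s := univ) (a := (j : ℝ)) (b := k) (c := k + 1)
      (by exact_mod_cast hjk) (by linarith) (mem_univ _)
    simp only [univ_inter] at h1
    have h2 := eVariationOn_Icc_le_of_dist_le (by linarith) (ha k) (hf k)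
    rw [add_sub_cancel_left, mul_one] at h2
    rw [Nat.cast_add_one, ← h1, Finset.sum_Ico_succ_top hjk,
      ENNReal.ofReal_add (Finset.sum_nonneg fun i _ => ha i) (ha k)]
    exact add_le_add ih h2

theorem continuousOn_Icc_of_piecewise_dist_le
    (hf : ∀ i : ℕ, ∀ s ∈ Icc (i : ℝ) (i + 1), ∀ t ∈ Icc (i : ℝ) (i + 1),
      dist (f s) (f t) ≤ a i * |s - t|) (n : ℕ) :
    ContinuousOn f (Icc (0 : ℝ) n) := by
  induction n with
  | zero => simp
  | succ n ih =>
    have h1 : ContinuousOn f (Icc (n : ℝ) (n + 1)) := by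
      refine (LipschitzOnWith.of_dist_le_mul (K := (a n).toNNReal) fun s hs t ht => ?_).continuousOn
      rw [Real.dist_eq]
      exact (hf n s hs t ht).trans
        (mul_le_mul_of_nonneg_right (Real.le_coe_toNNReal _) (abs_nonneg _))
    rw [Nat.cast_add_one, ← Icc_union_Icc_eq_Icc (b := (n : ℝ)) (by positivity) (by linarith)]
    exact ih.union_of_isClosed h1 isClosed_Icc isClosed_Icc

end PiecewiseLipschitz

/-- A sequence of points in a geodesic space is interpolated by a piecewise geodesic curve. -/
theorem exists_piecewise_geodesic {W : Type*} [MetricSpace W] [GeodesicSpace W] (y : ℕ → W) :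
    ∃ β : ℝ → W, (∀ i : ℕ, β i = y i) ∧
      ∀ i : ℕ, ∀ s ∈ Icc (i : ℝ) (i + 1), ∀ t ∈ Icc (i : ℝ) (i + 1),
        dist (β s) (β t) ≤ dist (y i) (y (i + 1)) * |s - t| := by
  choose g hg0 hg1 hg using fun i : ℕ => GeodesicSpace.exists_geodesic (y i) (y (i + 1))
  let β : ℝ → W := fun s => g ⌊s⌋₊ (dist (y ⌊s⌋₊) (y (⌊s⌋₊ + 1)) * (s - ⌊s⌋₊))
  have hβ : ∀ i : ℕ, ∀ s ∈ Icc (i : ℝ) (i + 1),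
      β s = g i (dist (y i) (y (i + 1)) * (s - i)) := by
    intro i s hs
    -- At the right endpoint the floor already selects the next geodesic, which starts where this
    -- one ends.
    rcases hs.2.eq_or_lt with rfl | hlt
    · have : ⌊(i : ℝ) + 1⌋₊ = i + 1 := by exact_mod_cast Nat.floor_natCast (R := ℝ) (i + 1)
      simp [β, this, hg0, hg1]
    · have : ⌊s⌋₊ = i := (Nat.floor_eq_iff ((Nat.cast_nonneg i).trans hs.1)).2 ⟨hs.1, hlt⟩
      simp [β, this]
  refine ⟨β, fun i => by simp [β, hg0], fun i s hs t ht => ?_⟩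
  have hm : ∀ r ∈ Icc (i : ℝ) (i + 1),
      dist (y i) (y (i + 1)) * (r - i) ∈ Icc 0 (dist (y i) (y (i + 1))) := fun r hr =>
    ⟨mul_nonneg dist_nonneg (by linarith [hr.1]),
      mul_le_of_le_one_right dist_nonneg (by linarith [hr.2])⟩
  rw [hβ i s hs, hβ i t ht, hg i _ (hm s hs) _ (hm t ht), ← mul_sub, abs_mul,
    abs_of_nonneg dist_nonneg, sub_sub_sub_cancel_right]

namespace IsConformalChange

variable {W W' : Type*} [MetricSpace W] [MetricSpace W'] {e : W ≃ W'} {ρ : W → ℝ} {κ : ℝ}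

/-- Interpolating a chain of points by geodesics yields a uniform curve, if the chain satisfies the
discrete versions of the two conditions for a uniform curve. -/
theorem exists_path_of_chain [ProperSpace W] [GeodesicSpace W] (h : IsConformalChange e ρ κ)
    (hne : (metricBoundary W').Nonempty) {M A₁ A₂ : ℝ} (hA₂ : 0 ≤ A₂) {y : ℕ → W} {n : ℕ}
    (hn : 0 < n) (hM : ∀ i, dist (y i) (y (i + 1)) ≤ M)
    (hlen : ∑ i ∈ Finset.range n, ρ (y i) * dist (y i) (y (i + 1)) ≤
      A₁ * dist (e (y 0)) (e (y n)))
    (hcone : ∀ k < n, ∑ i ∈ Finset.range (k + 1), ρ (y i) ≤ A₂ * ρ (y k) ∨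
      ∑ i ∈ Finset.Ico k n, ρ (y i) ≤ A₂ * ρ (y k)) :
    ∃ γ : Path (e (y 0)) (e (y n)),
      eVariationOn γ univ ≤
        ENNReal.ofReal (Real.exp (κ * M) * Real.exp (κ * M) * A₁ * dist (e (y 0)) (e (y n))) ∧
      ∀ t : unitInterval, min (eVariationOn γ (Iic t)) (eVariationOn γ (Ici t)) ≤
        ENNReal.ofReal (Real.exp (κ * M) * Real.exp (κ * M) * M * A₂ * Real.exp (κ * M) *
          Real.exp κ * distToBoundary (γ t)) := by
  have hM0 : 0 ≤ M := dist_nonneg.trans (hM 0)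
  have hκ := h.nonneg
  obtain ⟨β, hβ, hβd⟩ := exists_piecewise_geodesic y
  set D := Real.exp (κ * M) with hD
  -- One `D` is the exponential factor in `upper`, the other moves the density from a point of the
  -- segment to `y i`.
  set a : ℕ → ℝ := fun i => D * D * (ρ (y i) * dist (y i) (y (i + 1))) with ha
  have hmem : ∀ i : ℕ, (i : ℝ) ∈ Icc (i : ℝ) (i + 1) := fun i => ⟨le_rfl, by linarith⟩
  have hnear : ∀ i : ℕ, ∀ s ∈ Icc (i : ℝ) (i + 1), ∀ t ∈ Icc (i : ℝ) (i + 1),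
      dist (β s) (β t) ≤ M := fun i s hs t ht =>
    (hβd i s hs t ht).trans ((mul_le_of_le_one_right dist_nonneg
      (by rw [abs_le]; constructor <;> linarith [hs.1, hs.2, ht.1, ht.2])).trans (hM i))
  have ha0 : ∀ i, 0 ≤ a i := fun i => by have := h.pos (y i); positivity
  have hf : ∀ i : ℕ, ∀ s ∈ Icc (i : ℝ) (i + 1), ∀ t ∈ Icc (i : ℝ) (i + 1),
      dist ((e ∘ β) s) ((e ∘ β) t) ≤ a i * |s - t| := by
    intro i s hs t ht
    have h1 : ρ (β s) ≤ D * ρ (y i) := hβ i ▸ h.harnack_of_le (hnear i _ (hmem i) s hs)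
    have h2 := hβd i s hs t ht
    have h3 := hnear i s hs t ht
    have h4 := (h.pos (β s)).le
    have h5 := (h.pos (y i)).le
    calc dist (e (β s)) (e (β t)) ≤ _ := h.upper _ _
      _ ≤ D * (D * ρ (y i)) * (dist (y i) (y (i + 1)) * |s - t|) := by
          rw [hD]; rw [hD] at h1
          gcongr
      _ = _ := by simp only [ha]; ring
  have hn0 : (0 : ℝ) < n := by exact_mod_cast hn
  have hm : ∀ t : unitInterval, (n : ℝ) * t ∈ Icc (0 : ℝ) n := fun t =>
    ⟨mul_nonneg hn0.le t.2.1, mul_le_of_le_one_right hn0.le t.2.2⟩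
  let γ : Path (e (y 0)) (e (y n)) :=
    { toFun := fun t => (e ∘ β) (n * t)
      continuous_toFun := (continuousOn_Icc_of_piecewise_dist_le hf n).comp_continuous
        (by fun_prop) hm
      source' := by simpa using congrArg e (hβ 0)
      target' := by simp [hβ] }
  have hvar : ∀ (S : Set unitInterval) (u : Set ℝ), (∀ t ∈ S, (n : ℝ) * t ∈ u) →
      eVariationOn γ S ≤ eVariationOn (e ∘ β) u := fun S u hS =>
    eVariationOn.comp_le_of_monotoneOn (e ∘ β) (fun t : unitInterval => (n : ℝ) * t)
      (fun s _ t _ hst => mul_le_mul_of_nonneg_left (by exact_mod_cast hst) hn0.le) hS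
  refine ⟨γ, ?_, fun t => ?_⟩
  · refine (hvar univ (Icc ((0 : ℕ) : ℝ) n) fun t _ => by simpa using hm t).trans
      ((eVariationOn_Icc_le_sum ha0 hf n.zero_le).trans (ENNReal.ofReal_le_ofReal ?_))
    rw [← Finset.mul_sum, mul_assoc (D * D), Nat.Ico_zero_eq_range]
    gcongr
  · obtain ⟨k, hk, htk⟩ : ∃ k < n, (n : ℝ) * t ∈ Icc (k : ℝ) (k + 1) := by
      -- At `t = 1` the floor would be `n`, one past the last segment.
      rcases (hm t).2.eq_or_lt with heq | hlt
      · obtain ⟨m, rfl⟩ := Nat.exists_eq_add_of_lt hn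
        refine ⟨m, by omega, ?_⟩
        rw [heq]
        push_cast
        constructor <;> linarith
      · exact ⟨⌊(n : ℝ) * t⌋₊, (Nat.floor_lt (hm t).1).2 hlt, Nat.floor_le (hm t).1,
          (Nat.lt_floor_add_one _).le⟩
    have hk' : (k : ℝ) + 1 ≤ n := by exact_mod_cast hk
    -- The third `D` compares `y k` with the actual point of the curve; `exp κ` comes from
    -- `le_distToBoundary`.
    have hfinal : ∀ T : Finset ℕ, ∑ i ∈ T, ρ (y i) ≤ A₂ * ρ (y k) → ∑ i ∈ T, a i ≤
        D * D * M * A₂ * D * Real.exp κ * distToBoundary (γ t) := by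
      intro T hT
      have h1 : ρ (y k) ≤ D * ρ (β (n * t)) :=
        hβ k ▸ h.harnack_of_le (hnear k _ htk _ (hmem k))
      have h2 := h.le_distToBoundary hne (β (n * t))
      rw [Real.exp_neg, inv_mul_le_iff₀ (Real.exp_pos _)] at h2
      calc ∑ i ∈ T, a i ≤ ∑ i ∈ T, D * D * (ρ (y i) * M) := by
            refine Finset.sum_le_sum fun i _ => ?_
            have := (h.pos (y i)).le
            have := hM i
            simp only [ha]
            gcongr
        _ = D * D * M * ∑ i ∈ T, ρ (y i) := by
            rw [Finset.mul_sum]; exact Finset.sum_congr rfl fun i _ => by ring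
        _ ≤ D * D * M * (A₂ * (D * (Real.exp κ * distToBoundary (γ t)))) := by
            gcongr
            refine hT.trans ?_
            gcongr
            refine h1.trans ?_
            gcongr
            exact h2
        _ = _ := by ring
    rcases hcone k hk with hc | hc
    · refine (min_le_left _ _).trans ((hvar _ (Icc ((0 : ℕ) : ℝ) ((k + 1 : ℕ) : ℝ)) ?_).trans
        ((eVariationOn_Icc_le_sum ha0 hf (k + 1).zero_le).trans
          (ENNReal.ofReal_le_ofReal (hfinal _ ?_))))
      · intro s hs
        have : (n : ℝ) * s ≤ n * t := mul_le_mul_of_nonneg_left (by exact_mod_cast hs) hn0.le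
        push_cast
        exact ⟨(hm s).1, this.trans htk.2⟩
      · rwa [Nat.Ico_zero_eq_range]
    · refine (min_le_right _ _).trans ((hvar _ (Icc (k : ℝ) n) ?_).trans
        ((eVariationOn_Icc_le_sum ha0 hf hk.le).trans
          (ENNReal.ofReal_le_ofReal (hfinal _ hc))))
      intro s hs
      have : (n : ℝ) * t ≤ n * s := mul_le_mul_of_nonneg_left (by exact_mod_cast hs) hn0.le
      exact ⟨htk.1.trans this, (hm s).2⟩

end IsConformalChange

/-- A path can be subdivided so that consecutive points are at distance exactly `1`, except for the
last pair. -/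
theorem exists_unit_subdivision {X : Type*} [PseudoMetricSpace X] {c : unitInterval → X}
    (hc : Continuous c) : ∃ (t : ℕ → unitInterval) (n : ℕ), Monotone t ∧ t 0 = 0 ∧
      (∀ i, n ≤ i → t i = 1) ∧ (∀ i, dist (c (t i)) (c (t (i + 1))) ≤ 1) ∧
      ∀ i, i + 1 < n → dist (c (t i)) (c (t (i + 1))) = 1 := by
  have hnext : ∀ s : unitInterval, ∃ s', s ≤ s' ∧ dist (c s) (c s') ≤ 1 ∧
      (s' = 1 ∨ dist (c s) (c s') = 1) := by
    intro s
    rcases le_total (dist (c s) (c 1)) 1 with h1 | h1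
    · exact ⟨1, s.2.2, h1, Or.inl rfl⟩
    · have hcont : Continuous fun r => dist (c s) (c r) := continuous_const.dist hc
      obtain ⟨s', hs', h2⟩ := intermediate_value_Icc (show s ≤ 1 from s.2.2) hcont.continuousOn
        (show (1 : ℝ) ∈ _ from ⟨by simp, h1⟩)
      exact ⟨s', hs'.1, h2.le, Or.inr h2⟩
  choose nx hle hd hor using hnext
  obtain ⟨η, hη, hunif⟩ := Metric.uniformContinuous_iff.1
    (CompactSpace.uniformContinuous_of_continuous hc) 1 one_pos
  set t : ℕ → unitInterval := fun i => nx^[i] 0 with ht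
  have hsucc : ∀ i, t (i + 1) = nx (t i) := fun i => Function.iterate_succ_apply' nx i 0
  have hmono : Monotone t := monotone_nat_of_le_succ fun i => by rw [hsucc]; exact hle _
  -- By uniform continuity a step of length 1 advances the parameter by at least `η`, so 1 is
  -- reached after finitely many steps.
  have hprog : ∀ i, t i = 1 ∨ (i : ℝ) * η ≤ t i := by
    intro i
    induction i with
    | zero => right; simp [ht]
    | succ i ih =>
      rcases ih with ih | ih
      · exact Or.inl (le_antisymm (t (i + 1)).2.2 (ih ▸ hmono i.le_succ))
      · rcases hor (t i) with h1 | h1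
        · exact Or.inl (by rw [hsucc, h1])
        · right
          by_contra! hlt
          have h2 : dist (t i) (t (i + 1)) < η := by
            rw [dist_comm, Subtype.dist_eq, Real.dist_eq,
              abs_of_nonneg (sub_nonneg.2 (by exact_mod_cast hmono i.le_succ))]
            push_cast at hlt
            linarith
          have h3 := hunif h2
          rw [hsucc, h1] at h3
          exact lt_irrefl _ h3
  have hex : ∃ n, t n = 1 := by
    obtain ⟨n, hn⟩ := exists_nat_gt (1 / η)
    rw [div_lt_iff₀ hη] at hn
    exact ⟨n, (hprog n).resolve_right (by linarith [(t n).2.2])⟩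
  classical
  -- Minimality of the index ensures that only the step arriving at 1 can be short.
  refine ⟨t, Nat.find hex, hmono, rfl, fun i hi => ?_, fun i => by rw [hsucc]; exact hd _,
    fun i hi => ?_⟩
  · exact le_antisymm (t i).2.2 (Nat.find_spec hex ▸ hmono hi)
  · have h1 := Nat.find_min hex hi
    rw [hsucc] at h1 ⊢
    exact (hor (t i)).resolve_left h1

/-! ### Transfer of uniformity along rough isometries -/

/-- At large scale, a map that is Lipschitz up to an additive constant remains Lipschitz for the
conformal metrics given by comparable densities. -/
theorem IsConformalChange.exists_dist_le_conformalDist {X X' Y : Type*} [MetricSpace X]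
    [MetricSpace X'] [MetricSpace Y] [GeodesicSpace Y] {e : X ≃ X'} {ρ : X → ℝ} {κ : ℝ}
    (h : IsConformalChange e ρ κ) {φ : Y → X} {ℓ B : ℝ} (hℓ : 0 ≤ ℓ) (hB : 0 < B)
    (hφ : ∀ p q, dist (φ p) (φ q) ≤ dist p q + ℓ) {σ : Y → ℝ} (hσ : Continuous σ)
    (hσκ : ∀ p q, σ q ≤ Real.exp (κ * dist p q) * σ p) (hσ0 : ∀ p, 0 < σ p)
    (hρσ : ∀ p, ρ (φ p) ≤ B * σ p) :
    ∃ C : ℝ, 0 ≤ C ∧ ∀ p q : Y, 1 ≤ dist p q →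
      dist (e (φ p)) (e (φ q)) ≤ C * conformalDist σ p q := by
  have hκ := h.nonneg
  set C := Real.exp (κ * (2 + ℓ)) * B * (2 + ℓ) * Real.exp (κ * 2) with hC
  have hC0 : 0 < C := by positivity
  refine ⟨C, hC0.le, fun p q hpq => ?_⟩
  rw [← div_le_iff₀' hC0]
  refine le_conformalDist fun γ L hγ => ?_
  rw [div_le_iff₀' hC0]
  have hL : 1 ≤ L := by
    have := hγ.dist_le le_rfl hγ.1 le_rfl
    rw [hγ.2.1, hγ.2.2.1, sub_zero] at this
    exact hpq.trans this
  -- Equal arcs of length `L / n` in `[1, 2]`: long enough for the integral over each to dominate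
  -- the density at its start, short enough for Harnack.
  set n := ⌊L⌋₊ with hn
  have hn1 : (1 : ℝ) ≤ n := by exact_mod_cast Nat.one_le_floor_iff L |>.2 hL
  have hnL : (n : ℝ) ≤ L := Nat.floor_le (by linarith)
  have hLn : L < n + 1 := Nat.lt_floor_add_one L
  set η := L / n with hη
  have hη1 : 1 ≤ η := by rw [hη, le_div_iff₀ (by linarith)]; linarith
  have hη2 : η ≤ 2 := by rw [hη, div_le_iff₀ (by linarith)]; linarith
  have hnη : n * η = L := by rw [hη]; field_simp
  have hmem : ∀ k ≤ n, (k : ℝ) * η ∈ Icc 0 L := fun k hk => by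
    have : (k : ℝ) ≤ n := by exact_mod_cast hk
    refine ⟨by positivity, ?_⟩
    rw [← hnη]
    gcongr
  have hsucc : ∀ k : ℕ, ((k + 1 : ℕ) : ℝ) * η = k * η + η := fun k => by push_cast; ring
  have hint : ∀ k < n, IntervalIntegrable (fun t => σ (γ t)) MeasureTheory.volume
      ((k : ℝ) * η) ((k + 1 : ℕ) * η) := fun k hk =>
    hγ.intervalIntegrable hσ (hmem k hk.le) (hmem (k + 1) hk)
  have hstep : ∀ k < n, dist (e (φ (γ ((k : ℝ) * η)))) (e (φ (γ (((k + 1 : ℕ) : ℝ) * η)))) ≤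
      C * ∫ t in ((k : ℝ) * η)..((k + 1 : ℕ) * η), σ (γ t) := by
    intro k hk
    have hle : (k : ℝ) * η ≤ (k + 1 : ℕ) * η := by rw [hsucc]; linarith
    have h1 := hγ.dist_le (hmem k hk.le).1 hle (hmem (k + 1) hk).2
    rw [hsucc, add_sub_cancel_left, ← hsucc] at h1
    have h2 : dist (φ (γ ((k : ℝ) * η))) (φ (γ (((k + 1 : ℕ) : ℝ) * η))) ≤ 2 + ℓ := by
      linarith [hφ (γ ((k : ℝ) * η)) (γ (((k + 1 : ℕ) : ℝ) * η))]
    have h3 : ∫ _ in ((k : ℝ) * η)..((k + 1 : ℕ) * η), Real.exp (-(κ * 2)) * σ (γ (k * η)) ≤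
        ∫ t in ((k : ℝ) * η)..((k + 1 : ℕ) * η), σ (γ t) := by
      refine intervalIntegral.integral_mono_on hle (by simp) (hint k hk) fun t ht => ?_
      have h4 := hγ.dist_le (hmem k hk.le).1 ht.1 (ht.2.trans (hmem (k + 1) hk).2)
      rw [Real.exp_neg, inv_mul_le_iff₀ (Real.exp_pos _)]
      refine (hσκ (γ t) _).trans ?_
      refine mul_le_mul_of_nonneg_right (Real.exp_le_exp.2 ?_) (hσ0 _).le
      refine mul_le_mul_of_nonneg_left ?_ hκ
      have := ht.2
      rw [hsucc] at this
      rw [dist_comm]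
      linarith
    rw [intervalIntegral.integral_const, hsucc, add_sub_cancel_left, ← hsucc, smul_eq_mul] at h3
    have h5 : Real.exp (-(κ * 2)) * σ (γ (k * η)) ≤
        η * (Real.exp (-(κ * 2)) * σ (γ (k * η))) := by
      have := hσ0 (γ (k * η))
      exact le_mul_of_one_le_left (by positivity) hη1
    have h6 := h5.trans h3
    rw [Real.exp_neg, inv_mul_le_iff₀ (Real.exp_pos _)] at h6
    have h7 := (h.pos (φ (γ (k * η)))).le
    calc _ ≤ _ := h.upper _ _
      _ ≤ Real.exp (κ * (2 + ℓ)) * ρ (φ (γ (k * η))) * (2 + ℓ) := by gcongr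
      _ ≤ Real.exp (κ * (2 + ℓ)) * (B * (Real.exp (κ * 2) *
          ∫ t in ((k : ℝ) * η)..((k + 1 : ℕ) * η), σ (γ t))) * (2 + ℓ) := by
        have := hρσ (γ (k * η))
        gcongr
        refine this.trans ?_
        gcongr
      _ = _ := by rw [hC]; ring
  have hsum := intervalIntegral.sum_integral_adjacent_intervals
    (a := fun k : ℕ => (k : ℝ) * η) hint
  have hd := dist_le_range_sum_dist (fun k : ℕ => e (φ (γ ((k : ℝ) * η)))) n
  simp only [Nat.cast_zero, zero_mul, hnη, hγ.2.1, hγ.2.2.1] at hd hsum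
  rw [← hsum, Finset.mul_sum]
  exact hd.trans (Finset.sum_le_sum fun k hk => hstep k (Finset.mem_range.1 hk))

/-- A rough isometry says nothing at small scale, so only a discretised curve of `X'` is
transported, and all gaps are filled by geodesics of `Y`. -/
theorem isUniformMetricSpace_of_isRoughIsometry {X X' Y Y' : Type*} [MetricSpace X]
    [MetricSpace X'] [MetricSpace Y] [MetricSpace Y'] [ProperSpace Y] [GeodesicSpace Y]
    {e : X ≃ X'} {f : Y ≃ Y'} {ρ : X → ℝ} {σ : Y → ℝ} {κ : ℝ} (he : IsConformalChange e ρ κ)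
    (hf : IsConformalChange f σ κ) {lam B C D : ℝ} {φ : Y → X} (hφ : IsRoughIsometry lam φ)
    (hB : 0 ≤ B) (hC : 0 ≤ C) (hD : 0 ≤ D)
    (hρσ : ∀ y, ρ (φ y) ≤ B * σ y) (hσρ : ∀ y, σ y ≤ B * ρ (φ y))
    (hdist : ∀ p q : Y, 1 ≤ dist p q → dist (e (φ p)) (e (φ q)) ≤ C * dist (f p) (f q))
    (hbdX : ∀ x, distToBoundary (e x) ≤ D * ρ x) (hne : (metricBoundary Y').Nonempty)
    (hX : IsUniformMetricSpace X') : IsUniformMetricSpace Y' := by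
  obtain ⟨A, hA1, -, -, hA⟩ := hX
  have hA0 : 0 ≤ A := by linarith
  obtain ⟨hφd, τ₀, hτ₀⟩ := hφ
  obtain ⟨τ, hτ0, hτ⟩ : ∃ τ : ℝ, 0 ≤ τ ∧ ∀ x, ∃ y, dist x (φ y) ≤ τ :=
    ⟨max τ₀ 0, le_max_right _ _, fun x => (hτ₀ x).imp fun y hy => hy.trans (le_max_left _ _)⟩
  have hκ := he.nonneg
  -- A unit step in `X`, two displacements into the image of `φ`, and the additive distortion. The
  -- same `M` separates near pairs from far ones.
  set M : ℝ := 1 + 2 * τ + |lam| with hM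
  set E := Real.exp (κ * τ) with hE
  set G := Real.exp κ with hG
  -- The first summand serves near pairs, the second far pairs.
  set A₁ : ℝ := M * G + M * (B * E * ((1 + G) * (G * (A * C)))) with hA₁
  set F : ℝ := 1 + (1 + G) * (G * (A * D)) with hF
  set A₂ : ℝ := 1 + B * E * F * (E * B) with hA₂
  have habs := abs_nonneg lam
  have hM1 : 1 ≤ M := by linarith
  have hM0 : 0 ≤ M := by linarith
  have hG0 : 0 < G := Real.exp_pos _
  have hE0 : 0 < E := Real.exp_pos _
  have hF0 : 0 ≤ F := by positivity
  have hA₂1 : 1 ≤ A₂ := by rw [hA₂]; linarith [show 0 ≤ B * E * F * (E * B) by positivity]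
  have hA₂0 : 0 ≤ A₂ := by linarith
  have hchain : ∀ p q : Y, ∃ (y : ℕ → Y) (n : ℕ), y 0 = p ∧ y n = q ∧ 0 < n ∧
      (∀ i, dist (y i) (y (i + 1)) ≤ M) ∧
      ∑ i ∈ Finset.range n, σ (y i) * dist (y i) (y (i + 1)) ≤ A₁ * dist (f p) (f q) ∧
      ∀ k < n, ∑ i ∈ Finset.range (k + 1), σ (y i) ≤ A₂ * σ (y k) ∨
        ∑ i ∈ Finset.Ico k n, σ (y i) ≤ A₂ * σ (y k) := by
    intro p q
    rcases le_or_gt (dist p q) M with hpq | hpq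
    · refine ⟨fun i => if i = 0 then p else q, 1, by simp, by simp, one_pos, fun i => ?_, ?_,
        fun k hk => ?_⟩
      · rcases Nat.eq_zero_or_pos i with rfl | hi
        · simpa using hpq
        · simpa [hi.ne'] using hM0
      · have h1 := hf.lower p q
        rw [Real.exp_neg, mul_assoc, inv_mul_le_iff₀ (Real.exp_pos _)] at h1
        have h2 : dist p q ≤ M * min 1 (dist p q) := by
          rw [mul_min_of_nonneg _ _ hM0, mul_one]
          exact le_min hpq (le_mul_of_one_le_left dist_nonneg hM1)
        have h3 := (hf.pos p).le
        simp only [Finset.range_one, Finset.sum_singleton, if_true, zero_add, one_ne_zero, if_false]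
        calc σ p * dist p q ≤ σ p * (M * min 1 (dist p q)) := by gcongr
          _ = M * (σ p * min 1 (dist p q)) := by ring
          _ ≤ M * (G * dist (f p) (f q)) := by gcongr
          _ = M * G * dist (f p) (f q) := by ring
          _ ≤ A₁ * dist (f p) (f q) := by
            gcongr
            rw [hA₁]
            linarith [show 0 ≤ M * (B * E * ((1 + G) * (G * (A * C)))) by positivity]
      · obtain rfl : k = 0 := by omega
        left
        simpa using le_mul_of_one_le_left (hf.pos p).le hA₂1
    · obtain ⟨γ, -, hγlen, hγ⟩ := hA (e (φ p)) (e (φ q))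
      set c : unitInterval → X := fun t => e.symm (γ t) with hc
      have hγc : ∀ t, e (c t) = γ t := fun t => e.apply_symm_apply _
      obtain ⟨t, n, hmono, ht0, ht1, hd1, hd2⟩ :=
        exists_unit_subdivision (c := c) (he.continuous_symm.comp γ.continuous)
      have hc0 : c 0 = φ p := by simp [hc]
      have hc1 : c 1 = φ q := by simp [hc]
      -- A single step would give `dist (φ p) (φ q) ≤ 1`, hence `dist p q ≤ M`. Two steps guarantee
      -- a full one before the possibly short last one.
      have hn2 : 2 ≤ n := by
        by_contra! hlt
        have h1 := hd1 0
        rw [ht0, ht1 (0 + 1) (by omega), hc0, hc1] at h1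
        linarith [(hφd p q).1, le_abs_self lam]
      obtain ⟨m, rfl⟩ := Nat.exists_eq_add_of_le' hn2
      choose ψ hψ using hτ
      obtain ⟨y, hy0, hyn, hy⟩ : ∃ y : ℕ → Y, y 0 = p ∧ y (m + 2) = q ∧
          ∀ i, dist (c (t i)) (φ (y i)) ≤ τ := by
        refine ⟨fun i => if i = 0 then p else if m + 2 ≤ i then q else ψ (c (t i)), by simp,
          by simp, fun i => ?_⟩
        dsimp only
        split_ifs with h1 h2
        · rw [h1, ht0, hc0, dist_self]; exact hτ0
        · rw [ht1 i h2, hc1, dist_self]; exact hτ0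
        · exact hψ _
      set r : ℕ → ℝ := fun i => ρ (c (t i)) with hr
      have hr0 : ∀ i, 0 ≤ r i := fun i => (he.pos _).le
      have hyr : ∀ i, σ (y i) ≤ B * E * r i := fun i => by
        have h1 := he.harnack_of_le (hy i)
        calc σ (y i) ≤ B * ρ (φ (y i)) := hσρ _
          _ ≤ B * (E * r i) := by gcongr
          _ = _ := by ring
      have hry : ∀ i, r i ≤ E * B * σ (y i) := fun i => by
        have h1 := he.harnack_of_le ((dist_comm _ _).trans_le (hy i))
        calc r i ≤ E * ρ (φ (y i)) := h1
          _ ≤ E * (B * σ (y i)) := by have := hρσ (y i); gcongr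
          _ = _ := by ring
      have hrs : ∀ i, r (i + 1) ≤ G * r i := fun i => by
        simpa only [mul_one] using he.harnack_of_le (hd1 i)
      have hstepM : ∀ i, dist (y i) (y (i + 1)) ≤ M := fun i => by
        have h1 := dist_triangle4 (φ (y i)) (c (t i)) (c (t (i + 1))) (φ (y (i + 1)))
        rw [dist_comm (φ (y i)) (c (t i))] at h1
        linarith [(hφd (y i) (y (i + 1))).1, hy i, hy (i + 1), hd1 i, le_abs_self lam]
      -- Each full unit step contributes at least `G⁻¹ * r i` to the variation; `k < m + 2` leaves
      -- out the last step, which may be short.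
      have hsum : ∀ (U : Set unitInterval) (j k : ℕ) (T : ℝ), k < m + 2 → 0 ≤ T →
          (∀ i ∈ Icc j k, t i ∈ U) → eVariationOn γ U ≤ ENNReal.ofReal T →
          ∑ i ∈ Finset.Ico j k, r i ≤ G * T := by
        intro U j k T hk hT hU hle
        have h1 := (eVariationOn.sum_le_of_monotoneOn_Icc (f := γ) (hmono.monotoneOn _) hU).trans
          hle
        rw [← inv_mul_le_iff₀ hG0, ← ENNReal.ofReal_le_ofReal_iff hT, Finset.mul_sum,
          ENNReal.ofReal_sum_of_nonneg fun i _ => mul_nonneg (inv_nonneg.2 hG0.le) (hr0 i)]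
        refine (Finset.sum_le_sum fun i hi => ?_).trans h1
        have h2 := he.lower (c (t i)) (c (t (i + 1)))
        rw [hd2 i (by have := (Finset.mem_Ico.1 hi).2; omega), min_self, mul_one, Real.exp_neg,
          hγc, hγc] at h2
        rw [edist_dist, dist_comm]
        exact ENNReal.ofReal_le_ofReal h2
      -- The length of the curve does not pay for the short last step, so its density is charged to
      -- the previous step by Harnack.
      have hlast : ∀ k ≤ m, ∑ i ∈ Finset.Ico k (m + 2), r i ≤
          (1 + G) * ∑ i ∈ Finset.Ico k (m + 1), r i := by
        intro k hk
        rw [Finset.sum_Ico_succ_top (by omega), add_mul, one_mul]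
        gcongr
        refine (hrs m).trans ?_
        gcongr
        exact Finset.single_le_sum (fun i _ => hr0 i) (Finset.mem_Ico.2 ⟨hk, m.lt_succ_self⟩)
      refine ⟨y, m + 2, hy0, hyn, by omega, hstepM, ?_, fun k hk => ?_⟩
      · have h1 := hsum univ 0 (m + 1) _ (by omega) (by positivity) (fun _ _ => mem_univ _) hγlen
        have h2 := hlast 0 m.zero_le
        have h3 := hdist p q (hM1.trans hpq.le)
        calc ∑ i ∈ Finset.range (m + 2), σ (y i) * dist (y i) (y (i + 1))
            ≤ ∑ i ∈ Finset.range (m + 2), M * (B * E) * r i := by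
              refine Finset.sum_le_sum fun i _ => ?_
              calc _ ≤ B * E * r i * M :=
                    mul_le_mul (hyr i) (hstepM i) dist_nonneg (by have := hr0 i; positivity)
                _ = _ := by ring
          _ = M * (B * E) * ∑ i ∈ Finset.Ico 0 (m + 2), r i := by
              rw [Finset.mul_sum, Nat.Ico_zero_eq_range]
          _ ≤ M * (B * E) * ((1 + G) * (G * (A * (C * dist (f p) (f q))))) := by
              gcongr
              refine h2.trans ?_
              gcongr
              refine h1.trans ?_
              gcongr
          _ = M * (B * E * ((1 + G) * (G * (A * C)))) * dist (f p) (f q) := by ring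
          _ ≤ A₁ * dist (f p) (f q) := by
              gcongr
              rw [hA₁]
              linarith [mul_nonneg hM0 hG0.le]
      · have hred : ∀ S : Finset ℕ, ∑ i ∈ S, r i ≤ F * r k → ∑ i ∈ S, σ (y i) ≤ A₂ * σ (y k) := by
          intro S hS
          calc ∑ i ∈ S, σ (y i) ≤ ∑ i ∈ S, B * E * r i := Finset.sum_le_sum fun i _ => hyr i
            _ = B * E * ∑ i ∈ S, r i := by rw [Finset.mul_sum]
            _ ≤ B * E * (F * (E * B * σ (y k))) := by
                gcongr
                refine hS.trans ?_
                gcongr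
                exact hry k
            _ = B * E * F * (E * B) * σ (y k) := by ring
            _ ≤ A₂ * σ (y k) := by
                have := (hf.pos (y k)).le
                gcongr
                linarith
        have hdk : ENNReal.ofReal (A * distToBoundary (γ (t k))) ≤
            ENNReal.ofReal (A * (D * r k)) := by
          refine ENNReal.ofReal_le_ofReal ?_
          gcongr
          rw [← hγc]
          exact hbdX _
        have hrk := hr0 k
        have hT : 0 ≤ A * (D * r k) := by positivity
        have hFG : G * (A * (D * r k)) ≤ (1 + G) * (G * (A * D)) * r k := by
          have h1 : 0 ≤ G * (A * (D * r k)) := by positivity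
          nlinarith [mul_nonneg hG0.le h1]
        -- On the left the variation up to `t k` sees only indices below `k`; the summand 1 in `F`
        -- covers the index `k`. On the right, `k = m + 1` leaves that single term.
        rcases min_le_iff.1 ((hγ (t k)).trans hdk) with h1 | h1
        · left
          refine hred _ ?_
          have h2 := hsum _ 0 k _ hk hT (fun i hi => hmono hi.2) h1
          rw [Finset.sum_range_succ, ← Nat.Ico_zero_eq_range, hF, add_mul, one_mul]
          linarith
        · right
          refine hred _ ?_
          rcases Nat.lt_succ_iff_lt_or_eq.1 hk with h2 | rfl
          · have h3 := hsum _ k (m + 1) _ (by omega) hT (fun i hi => hmono hi.1) h1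
            have h4 := hlast k (by omega)
            have h5 : (1 + G) * ∑ i ∈ Finset.Ico k (m + 1), r i ≤
                (1 + G) * (G * (A * (D * r k))) := by gcongr
            rw [hF, add_mul, one_mul]
            linarith
          · simp only [Nat.Ico_succ_singleton, Finset.sum_singleton]
            refine le_mul_of_one_le_left hrk ?_
            rw [hF]
            linarith [show 0 ≤ (1 + G) * (G * (A * D)) by positivity]
  set K₁ := Real.exp (κ * M) * Real.exp (κ * M) * A₁ with hK₁
  set K₂ := Real.exp (κ * M) * Real.exp (κ * M) * M * A₂ * Real.exp (κ * M) * Real.exp κ with hK₂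
  refine ⟨max 1 (max K₁ K₂), le_max_left _ _, hf.locallyCompactSpace,
    not_completeSpace_of_nonempty_metricBoundary hne, fun x' y' => ?_⟩
  obtain ⟨p, rfl⟩ := f.surjective x'
  obtain ⟨q, rfl⟩ := f.surjective y'
  obtain ⟨y, n, rfl, rfl, hn, hyM, hlen, hcone⟩ := hchain p q
  obtain ⟨γ, h1, h2⟩ := hf.exists_path_of_chain hne hA₂0 hn hyM hlen hcone
  refine ⟨γ, (h1.trans_lt ENNReal.ofReal_lt_top).ne,
    h1.trans (ENNReal.ofReal_le_ofReal (mul_le_mul_of_nonneg_right ?_ dist_nonneg)),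
    fun t => (h2 t).trans
      (ENNReal.ofReal_le_ofReal (mul_le_mul_of_nonneg_right ?_ Metric.infDist_nonneg))⟩
  · exact (le_max_left _ _).trans (le_max_right _ _)
  · exact (le_max_right _ _).trans (le_max_right _ _)

/-! ### Comparison of the two densities and rays to the boundary -/

theorem theorem4p1 {X Y : Type*}
    [MetricSpace X] [ProperSpace X] [GeodesicSpace X] [GromovHyperbolicSpace X]
    [MetricSpace Y] [ProperSpace Y] [GeodesicSpace Y] [GromovHyperbolicSpace Y]
    (lam : ℝ) (φ : Y → X) (hφ : IsRoughIsometry lam φ)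
    (ω : GromovBoundary Y) (ω' : GromovBoundary X) (hω' : ω' = hφ.boundaryMap ω)
    (hstar : IsRoughlyStarlike X ω')
    (o : Y) (o' : X) (ε : ℝ) (hε : 0 < ε)
    (hunif : IsUniformMetricSpace (BusemannDeformation X ω' o' ε)) :
    IsUniformMetricSpace (BusemannDeformation Y ω o ε) := by
  subst hω'
  have he := BusemannDeformation.isConformalChange X (hφ.boundaryMap ω) o' hε
  have hf := BusemannDeformation.isConformalChange Y ω o hε
  set ρ := busemannDensity (hφ.boundaryMap ω) o' ε with hρ
  set σ := busemannDensity ω o ε with hσ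
  have hlam : 0 ≤ lam := by linarith [(hφ.1 o o).1, (hφ.1 o o).2]
  obtain ⟨c, hc0, hc⟩ := hφ.exists_abs_busemann_sub_le ω o o'
  have hρσ : ∀ y, ρ (φ y) ≤ Real.exp (ε * c) * σ y := fun y => by
    simp only [hρ, hσ, busemannDensity]
    rw [← Real.exp_add, Real.exp_le_exp]
    nlinarith [(abs_le.1 (hc y)).1]
  have hσρ : ∀ y, σ y ≤ Real.exp (ε * c) * ρ (φ y) := fun y => by
    simp only [hρ, hσ, busemannDensity]
    rw [← Real.exp_add, Real.exp_le_exp]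
    nlinarith [(abs_le.1 (hc y)).2]
  obtain ⟨C, hC0, hC⟩ := he.exists_dist_le_conformalDist hlam (Real.exp_pos (ε * c))
    (fun p q => (hφ.1 p q).2) (continuous_busemannDensity ω o ε) hf.harnack hf.pos hρσ
  obtain ⟨K, hK0, hK⟩ := hstar
  obtain ⟨b, hb⟩ := exists_busemann_line_le X
  obtain ⟨τ, hτ⟩ := hφ.2
  have hθ : Real.exp (-ε) < 1 := Real.exp_zero ▸ Real.exp_lt_exp.2 (by linarith)
  -- Follow the line away from `ω'`, where the Busemann function grows at unit rate. The extra 1 in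
  -- `K + 1` allows a point of the line to be chosen from the bound on the infimum distance.
  have hray : ∀ x : X, ∃ p : ℕ → X, dist x (p 0) ≤ K + 1 ∧ (∀ n, dist (p n) (p (n + 1)) ≤ 1) ∧
      ∀ n, ρ (p n) ≤ Real.exp (ε * b) * ρ (p 0) * Real.exp (-ε) ^ n := by
    intro x
    obtain ⟨ζ, γ, hγ, hγω, -, hx⟩ := hK x
    obtain ⟨_, ⟨s, rfl⟩, hs⟩ := (Metric.infDist_lt_iff (range_nonempty γ)).1
      (hx.trans_lt (lt_add_one K))
    refine ⟨fun n => γ (s + n), by simpa using hs.le, fun n => ?_, fun n => ?_⟩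
    · rw [hγ.dist_eq, Real.dist_eq]
      push_cast
      rw [abs_le]
      constructor <;> linarith
    · have h1 := hb _ o' γ hγ hγω s (s + n) (by linarith [n.cast_nonneg (α := ℝ)])
      simp only [hρ, busemannDensity]
      rw [← Real.exp_nat_mul, ← Real.exp_add, ← Real.exp_add, Real.exp_le_exp, Nat.cast_zero,
        add_zero]
      nlinarith
  have hbdX : ∃ D : ℝ, 0 ≤ D ∧ ∀ x,
      distToBoundary (BusemannDeformation.of (hφ.boundaryMap ω) o' ε x) ≤ D * ρ x := by
    have hθ' : 0 < 1 - Real.exp (-ε) := by linarith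
    set P := Real.exp (2 * ε * (K + 1)) with hP
    refine ⟨P * (K + 1) + Real.exp (2 * ε * 1) * 1 * (Real.exp (ε * b) * P) / (1 - Real.exp (-ε)),
      by positivity, fun x => ?_⟩
    obtain ⟨p, hp0, hp1, hp⟩ := hray x
    obtain ⟨w, hw, hpw⟩ := he.exists_mem_metricBoundary (Real.exp_pos _).le hθ hp1 hp
    have h0 := (he.pos x).le
    have h1 := he.upper x (p 0)
    have h2 := he.harnack_of_le hp0
    refine (Metric.infDist_le_dist_of_mem hw).trans ((dist_triangle _ _ _).trans
      ((add_le_add (UniformSpace.Completion.dist_eq _ _).le hpw).trans ?_))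
    rw [add_mul]
    refine add_le_add (h1.trans ?_) ?_
    · calc _ ≤ P * ρ x * (K + 1) := by rw [hP]; gcongr
        _ = _ := by ring
    · rw [div_mul_eq_mul_div]
      refine div_le_div_of_nonneg_right ?_ hθ'.le
      calc _ ≤ Real.exp (2 * ε * 1) * 1 * (Real.exp (ε * b) * (P * ρ x)) := by gcongr
        _ = _ := by ring
  -- A coarse inverse `ψ` of `φ` turns a ray in `X` into a sequence in `Y` with bounded steps and,
  -- as the densities are comparable, geometric decay.
  have hne : (metricBoundary (BusemannDeformation Y ω o ε)).Nonempty := by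
    obtain ⟨p, -, hp1, hp⟩ := hray o'
    choose ψ hψ using hτ
    have hpψ : ∀ n, σ (ψ (p n)) ≤ Real.exp (ε * c) * (Real.exp (2 * ε * τ) *
        (Real.exp (ε * b) * ρ (p 0))) * Real.exp (-ε) ^ n := by
      intro n
      have h1 := he.harnack_of_le (hψ (p n))
      calc σ (ψ (p n)) ≤ Real.exp (ε * c) * ρ (φ (ψ (p n))) := hσρ _
        _ ≤ Real.exp (ε * c) * (Real.exp (2 * ε * τ) *
            (Real.exp (ε * b) * ρ (p 0) * Real.exp (-ε) ^ n)) := by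
          gcongr
          refine h1.trans ?_
          have := hp n
          gcongr
        _ = _ := by ring
    obtain ⟨w, hw, -⟩ := hf.exists_mem_metricBoundary (p := fun n => ψ (p n))
      (M := 1 + 2 * τ + lam) (Real.exp_pos _).le hθ (fun n => by
        have h1 := dist_triangle4 (φ (ψ (p n))) (p n) (p (n + 1)) (φ (ψ (p (n + 1))))
        rw [dist_comm (φ (ψ (p n))) (p n)] at h1
        linarith [(hφ.1 (ψ (p n)) (ψ (p (n + 1)))).1, hψ (p n), hψ (p (n + 1)), hp1 n]) hpψ
    exact ⟨w, hw⟩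
  obtain ⟨D, hD0, hD⟩ := hbdX
  exact isUniformMetricSpace_of_isRoughIsometry he hf hφ (Real.exp_pos _).le hC0 hD0 hρσ hσρ hC hD
    hne hunif
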